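/- Let $S$ be the set of positive integers that are not congruent to $2$ modulo $4$ and are either prime or squarefull (a positive integer is squarefull if every prime factor occurs in it with exponent at least $2$). For $X\in\mathbb{R}_{>0}$ put $$f(X)=\sum_{\substack{N\le X\\ N\in S}}\frac{\phi(N)}{N},$$ where $\phi$ is Euler's totient function. For $x\in\mathbb{R}_{>0}$ let $\lceil x\rceil^{\mathfrak p}$ be the smallest prime that is greater than or equal to $x$. For a positive integer $N$ let $\mathcal{D}_+(N)$ (resp. $\mathcal{D}_-(N)$) be the set of primitive Dirichlet characters $\chi$ mod $N$ with $\chi(-1)=1$ (resp. $\chi(-1)=-1$), and let $\tau(\chi)=\sum_{b=1}^{N}\chi(b)e^{2\pi i b/N}$ be the Gauss sum. For $y,X\in\mathbb{R}_{>0}$ and $\delta\in(0,1)$ define (whenever $f(X+X^\delta)\neq f(X)$) $$\widetilde{Q}^S_{\pm}(y,X,\delta)=\frac{1}{f(X+X^\delta)-f(X)}\sum_{\substack{N\in[X,X+X^\delta]\\ N\in S}}\ \sum_{\chi\in\mathcal{D}_\pm(N)}\frac{\chi(\lceil yX\rceil^{\mathfrak p})}{\tau(\chi)}.$$ Assume the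 Riemann hypothesis. If $\delta\in(\tfrac12,1)$ and $y\in\mathbb{R}_{>0}$, then, as $X\to\infty$ through the real numbers, $$\lim_{X\to\infty}\widetilde{Q}^S_{+}(y,X,\delta)=\cos(2\pi y)\qquad\text{and}\qquad \lim_{X\to\infty}\widetilde{Q}^S_{-}(y,X,\delta)=-i\sin(2\pi y).$$ -/

import Mathlib

open Filter Topology

noncomputable section

namespace DirichletMurmuration

/-- The smallest prime that is bigger than or equal to the real number `x`. -/
def nextPrime (x : ℝ) : ℕ := sInf {p : ℕ | p.Prime ∧ x ≤ (p : ℝ)}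

/-- The Gauss sum `τ(χ) = ∑_{b=1}^{N} χ(b) e^{2πib/N}` of a Dirichlet character mod `N`. -/
def tau {N : ℕ} (χ : DirichletCharacter ℂ N) : ℂ :=
  ∑ b ∈ Finset.Icc 1 N, χ (b : ZMod N) * Complex.exp (2 * Real.pi * Complex.I * b / N)

/-- The set of primitive even Dirichlet characters mod `N`. -/
def evenPrimitive (N : ℕ) : Set (DirichletCharacter ℂ N) := {χ | χ.IsPrimitive ∧ χ.Even}

/-- The set of primitive odd Dirichlet characters mod `N`. -/
def oddPrimitive (N : ℕ) : Set (DirichletCharacter ℂ N) := {χ | χ.IsPrimitive ∧ χ.Odd}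

/-- A positive integer is squarefull if all its prime factors have exponent at least `2`. -/
def Squarefull (N : ℕ) : Prop := 0 < N ∧ ∀ p : ℕ, p.Prime → p ∣ N → p ^ 2 ∣ N

/-- The positive integers not congruent to `2` mod `4` that are either prime or squarefull. -/
def S : Set ℕ := {N | 0 < N ∧ ¬ N ≡ 2 [MOD 4] ∧ (N.Prime ∨ Squarefull N)}

open Classical in
/-- `f(X) = ∑_{N ≤ X, N ∈ S} φ(N)/N`. -/
def f (X : ℝ) : ℝ :=
  ∑ N ∈ (Finset.Icc 1 ⌊X⌋₊).filter (fun N => N ∈ S), (Nat.totient N : ℝ) / (N : ℝ)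

open Classical in
/-- The average over the conductors `N ∈ S ∩ [X, X + X^δ]` of the sums of `χ(p) / τ(χ)` over
`χ ∈ D N`, where `p` is the smallest prime `≥ yX`, normalized by `f(X + X^δ) - f(X)`.
It is used with `D = evenPrimitive` and with `D = oddPrimitive`. -/
def QS (D : (N : ℕ) → Set (DirichletCharacter ℂ N)) (y X δ : ℝ) : ℂ :=
  1 / ((f (X + X ^ δ) - f X : ℝ) : ℂ) *
    ∑ N ∈ (Finset.Icc ⌈X⌉₊ ⌊X + X ^ δ⌋₊).filter (fun N => N ∈ S),
      ∑ᶠ χ ∈ D N, χ (nextPrime (y * X) : ZMod N) / tau χ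

end DirichletMurmuration

end

namespace DirichletMurmuration

/-! ### Gauss sums and orthogonality modulo a fixed N -/

section Characters

/-! For primitive `χ` one has `τ(χ) * conj τ(χ) = N`, so `χ(q) / τ(χ)` is `χ(q)` times a conjugate
Gauss sum over `N`. Summed over all characters of one parity, orthogonality collapses this to
`φ(N)/N` times `cos(2πq/N)` or `-i sin(2πq/N)`. The set `S` makes it harmless to include imprimitive
characters: their Gauss sums vanish when `N` is squarefull, and for prime `N` only the trivial
character intervenes, at cost `1/N` (`norm_sum_div_tau_sub_le`).

For `N` in the window `q/N` tends to `y` uniformly, because `N ~ X` and `q ~ yX`. The remaining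
errors (the `1/N` terms, the modulus `N = q`, the endpoint) stay bounded, while the normalising
factor diverges: the window contains about `X^(δ-1/2)` squares, each of weight at least a constant
over `log X` (`tendsto_f_sub_f`). This is where `δ > 1/2` enters.

The asymptotic `q ~ yX` (`tendsto_nextPrime_div`) comes from a Wiener-Ikehara type argument. Sums of
`Λ(n)/n` and of `1/n` against a Fejér kernel centred at `log x` differ by a Fourier transform of
`-ζ'/ζ - ζ` over a segment of `Re s = 1`, which tends to `0` by Riemann-Lebesgue. The second sum is
bounded below, whereas a prime-free window around `x` would make the first one small. -/

lemma inv_isPrimitive_iff {N : ℕ} {χ : DirichletCharacter ℂ N} :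
    χ⁻¹.IsPrimitive ↔ χ.IsPrimitive := by
  rw [DirichletCharacter.isPrimitive_def, DirichletCharacter.isPrimitive_def,
    DirichletCharacter.conductor_inv]

variable {N : ℕ} [NeZero N]

lemma tau_eq_gaussSum (χ : DirichletCharacter ℂ N) : tau χ = gaussSum χ ZMod.stdAddChar := by
  have hN : 0 < N := Nat.pos_of_ne_zero (NeZero.ne N)
  unfold tau gaussSum
  refine Finset.sum_bij (fun b _ => (b : ZMod N)) (fun _ _ => Finset.mem_univ _) ?_ ?_ ?_
  · intro a ha b hb h
    rw [Finset.mem_Icc] at ha hb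
    rw [ZMod.natCast_eq_natCast_iff] at h
    rcases lt_or_ge a b with hab | hab
    · have := (Nat.modEq_iff_dvd' hab.le).1 h
      have := Nat.le_of_dvd (by omega) this
      omega
    · have := (Nat.modEq_iff_dvd' hab).1 h.symm
      rcases Nat.eq_zero_or_pos (a - b) with h0 | h0
      · omega
      · have := Nat.le_of_dvd h0 this
        omega
  · intro x _
    by_cases hx : x.val = 0
    · exact ⟨N, Finset.mem_Icc.2 ⟨hN, le_rfl⟩, by
        rw [(ZMod.val_eq_zero x).1 hx]; simp⟩
    · exact ⟨x.val, Finset.mem_Icc.2 ⟨Nat.pos_of_ne_zero hx, (ZMod.val_lt x).le⟩, by simp⟩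
  · intro b _
    have := ZMod.stdAddChar_coe (N := N) (b : ℤ)
    push_cast at this
    rw [this]

/-- The Gauss sum of a primitive character times the conjugate Gauss sum is the modulus. -/
lemma gaussSum_mul_gaussSum_inv_of_isPrimitive {χ : DirichletCharacter ℂ N}
    (hχ : χ.IsPrimitive) {e : AddChar (ZMod N) ℂ} (he : e.IsPrimitive) :
    gaussSum χ⁻¹ (e.mulShift (-1)) * gaussSum χ e = N := by
  have h1 : gaussSum χ⁻¹ (e.mulShift (-1)) * gaussSum χ e
      = ∑ b, ∑ a, χ a * e (b * (a - 1)) := by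
    conv_lhs => rw [gaussSum, Finset.sum_mul]
    refine Finset.sum_congr rfl fun b _ => ?_
    -- Primitivity gives `χ⁻¹ b * gaussSum χ e = gaussSum χ (e.mulShift b)` for non-units `b` too.
    rw [mul_right_comm, ← gaussSum_mulShift_of_isPrimitive e hχ b, gaussSum, Finset.sum_mul]
    refine Finset.sum_congr rfl fun a _ => ?_
    rw [AddChar.mulShift_apply, AddChar.mulShift_apply, mul_assoc, ← AddChar.map_add_eq_mul]
    congr 2; ring
  rw [h1, Finset.sum_comm]
  simp_rw [← Finset.mul_sum, AddChar.sum_mulShift _ he, sub_eq_zero]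
  simp

/-- Gauss sums of imprimitive characters to a squarefull modulus vanish. -/
lemma gaussSum_eq_zero_of_squarefull (hN : Squarefull N) {χ : DirichletCharacter ℂ N}
    (hχ : ¬ χ.IsPrimitive) {e : AddChar (ZMod N) ℂ} (he : e.IsPrimitive) :
    gaussSum χ e = 0 := by
  obtain ⟨k, hk⟩ := χ.conductor_dvd_level
  have hk1 : k ≠ 1 := by
    rintro rfl
    exact hχ (by rw [DirichletCharacter.isPrimitive_def]; omega)
  obtain ⟨p, hp, l, rfl⟩ := Nat.exists_prime_and_dvd hk1
  obtain ⟨r, hr⟩ := hN.2 p hp ⟨χ.conductor * l, hk.trans (by ring)⟩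
  -- `M = N/p` is still a multiple of the conductor, and `p² ∣ N` gives `M² = 0` mod `N`. Hence `χ`
  -- is `M`-periodic, and translating the Gauss sum by `M` multiplies it by `e M ≠ 1`.
  set M := χ.conductor * l with hM
  have hNM : N = p * M := hk.trans (by rw [hM]; ring)
  have hMr : M = p * r := by
    have : p * M = p * (p * r) := by rw [← hNM, hr]; ring
    exact Nat.eq_of_mul_eq_mul_left hp.pos this
  have hM0 : 0 < M := Nat.pos_of_ne_zero fun h => NeZero.ne N (by rw [hNM, h, mul_zero])
  have hMdvd : M ∣ N := ⟨p, by rw [hNM]; ring⟩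
  have hsq : (M : ZMod N) * M = 0 := by
    rw [← Nat.cast_mul, ZMod.natCast_eq_zero_iff]
    exact ⟨r, by rw [hNM]; nth_rewrite 2 [hMr]; ring⟩
  have hF : χ.FactorsThrough M := χ.factorsThrough_conductor.mono χ ⟨l, rfl⟩ hMdvd
  have hker := (DirichletCharacter.factorsThrough_iff_ker_unitsMap hMdvd).1 hF
  have hone : ∀ c : ZMod N, χ (1 + c * M) = 1 := by
    intro c
    let u : (ZMod N)ˣ := ⟨1 + c * M, 1 - c * M,
      by linear_combination (-c ^ 2) * hsq, by linear_combination (-c ^ 2) * hsq⟩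
    have hu : u ∈ (ZMod.unitsMap hMdvd).ker := by
      rw [MonoidHom.mem_ker, ← Units.val_inj, ZMod.unitsMap_def, Units.coe_map]
      change ZMod.castHom hMdvd (ZMod M) (1 + c * M) = 1
      rw [map_add, map_one, map_mul, map_natCast, ZMod.natCast_self, mul_zero, add_zero]
    have := hker hu
    rw [MonoidHom.mem_ker, ← Units.val_inj] at this
    simpa [u] using this
  have hunit : ∀ b : ZMod N, IsUnit b → χ (b + M) = χ b := by
    rintro b ⟨v, rfl⟩
    have : (v : ZMod N) + M = v * (1 + (v⁻¹ : (ZMod N)ˣ) * M) := by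
      rw [mul_add, mul_one, ← mul_assoc, Units.mul_inv, one_mul]
    rw [this, map_mul, hone, mul_one]
  have hshift : ∀ b : ZMod N, χ (b + M) = χ b := by
    intro b
    by_cases hb : IsUnit b
    · exact hunit b hb
    · rw [MulChar.map_nonunit _ hb]
      refine MulChar.map_nonunit _ fun h => hb ?_
      obtain ⟨v, hv⟩ := h
      let u : (ZMod N)ˣ := ⟨1 + (v⁻¹ : (ZMod N)ˣ) * (-M), 1 - (v⁻¹ : (ZMod N)ˣ) * (-M),
        by linear_combination (-((v⁻¹ : (ZMod N)ˣ) : ZMod N) ^ 2) * hsq,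
        by linear_combination (-((v⁻¹ : (ZMod N)ˣ) : ZMod N) ^ 2) * hsq⟩
      have : b = ((v * u : (ZMod N)ˣ) : ZMod N) := by
        rw [Units.val_mul]
        simp only [u]
        rw [mul_add, mul_one, ← mul_assoc, Units.mul_inv, one_mul, hv]; ring
      rw [this]; exact Units.isUnit _
  have heM : e M ≠ 1 := by
    intro h
    have hM' : (M : ZMod N) ≠ 0 := by
      rw [Ne, ZMod.natCast_eq_zero_iff]
      intro h
      have := Nat.le_of_dvd hM0 h
      have := hp.two_le
      nlinarith
    refine he hM' ?_
    ext x
    rw [AddChar.mulShift_apply, AddChar.one_apply]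
    have : (M : ZMod N) * x = x.val • (M : ZMod N) := by
      rw [nsmul_eq_mul, ZMod.natCast_zmod_val, mul_comm]
    rw [this, AddChar.map_nsmul_eq_pow, h, one_pow]
  have : gaussSum χ e = gaussSum χ e * e M := by
    conv_lhs => rw [gaussSum, ← Equiv.sum_comp (Equiv.addRight (M : ZMod N))]
    rw [gaussSum, Finset.sum_mul]
    refine Finset.sum_congr rfl fun b _ => ?_
    simp only [Equiv.coe_addRight, hshift, AddChar.map_add_eq_mul, mul_assoc]
  have h2 : gaussSum χ e * (e M - 1) = 0 := by linear_combination -this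
  exact (mul_eq_zero.1 h2).resolve_right (sub_ne_zero.2 heM)

/-- The Gauss sum of an imprimitive character to a prime modulus. -/
lemma gaussSum_of_prime_of_not_isPrimitive (hN : N.Prime) {χ : DirichletCharacter ℂ N}
    (hχ : ¬ χ.IsPrimitive) {e : AddChar (ZMod N) ℂ} (he : e.IsPrimitive) :
    χ = 1 ∧ gaussSum χ e = -1 := by
  have hχ1 : χ = 1 := by
    rw [DirichletCharacter.eq_one_iff_conductor_eq_one]
    exact ((Nat.dvd_prime hN).1 χ.conductor_dvd_level).resolve_right hχ
  refine ⟨hχ1, ?_⟩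
  have : Fact N.Prime := ⟨hN⟩
  have hne : e ≠ 1 := by
    have := he (one_ne_zero (α := ZMod N))
    rwa [AddChar.mulShift_one] at this
  have h0 := AddChar.sum_eq_zero_of_ne_one hne
  rw [hχ1, gaussSum, Fintype.sum_eq_add_sum_compl (0 : ZMod N)]
  rw [Fintype.sum_eq_add_sum_compl (0 : ZMod N), AddChar.map_zero_eq_one] at h0
  rw [MulChar.map_zero, zero_mul, zero_add]
  rw [Finset.sum_congr rfl (g := fun x => e x)]
  · linear_combination h0
  · intro x hx
    have : x ≠ 0 := by simpa using hx
    rw [MulChar.one_apply (isUnit_iff_ne_zero.2 this), one_mul]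

/-- Opening the Gauss sum and summing over all characters first, orthogonality leaves only `b = q`.
-/
lemma sum_char_mul_gaussSum_inv {q : ZMod N} (hq : IsUnit q) (e : AddChar (ZMod N) ℂ) :
    ∑ χ : DirichletCharacter ℂ N, χ q * gaussSum χ⁻¹ e = N.totient * e q := by
  simp_rw [gaussSum, Finset.mul_sum]
  rw [Finset.sum_comm]
  have key : ∀ b : ZMod N, ∑ χ : DirichletCharacter ℂ N, χ q * (χ⁻¹ b * e b)
      = (if b = q then (N.totient : ℂ) else 0) * e b := by
    intro b
    by_cases hb : IsUnit b
    · rw [← DirichletCharacter.sum_char_inv_mul_char_eq ℂ hb q, Finset.sum_mul]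
      refine Finset.sum_congr rfl fun χ _ => ?_
      obtain ⟨v, rfl⟩ := hb
      rw [MulChar.inv_apply, Ring.inverse_unit, ZMod.inv_coe_unit]
      ring
    · have : b ≠ q := fun h => hb (h ▸ hq)
      rw [if_neg this, zero_mul]
      refine Finset.sum_eq_zero fun χ _ => ?_
      rw [MulChar.map_nonunit _ hb]; ring
  simp_rw [key]
  simp

/-- The sum of `χ(q) / τ(χ)` over the primitive characters of a given parity. -/
lemma norm_sum_div_tau_sub_le (hN : N.Prime ∨ Squarefull N) {q : ZMod N} (hq : IsUnit q)
    {s : ℂ} (hs : s = 1 ∨ s = -1) :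
    ‖∑ᶠ χ ∈ {χ : DirichletCharacter ℂ N | χ.IsPrimitive ∧ χ (-1) = s}, χ q / tau χ
      - (N.totient : ℂ) / N *
        ((ZMod.stdAddChar (-q) + s * ZMod.stdAddChar q) / 2)‖ ≤ 1 / N := by
  classical
  have hN0 : (N : ℂ) ≠ 0 := Nat.cast_ne_zero.2 (NeZero.ne N)
  set e : AddChar (ZMod N) ℂ := ZMod.stdAddChar
  have he : e.IsPrimitive := ZMod.isPrimitive_stdAddChar N
  set e' := e.mulShift (-1)
  have he' : e'.IsPrimitive := by
    intro a ha
    rw [AddChar.mulShift_mulShift]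
    exact he (by simpa using ha)
  have hterm : ∀ χ : DirichletCharacter ℂ N, χ.IsPrimitive →
      χ q / tau χ = χ q * gaussSum χ⁻¹ e' / N := by
    intro χ hχ
    have := gaussSum_mul_gaussSum_inv_of_isPrimitive hχ he
    have h0 : gaussSum χ e ≠ 0 := fun h => hN0 (by rw [← this, h, mul_zero])
    rw [tau_eq_gaussSum, div_eq_div_iff h0 hN0, ← this]
    ring
  -- The projector onto parity `s`; its `χ (-1)` factor turns `q` into `-q`, producing the second
  -- exponential.
  have hsign : ∀ χ : DirichletCharacter ℂ N, (1 + s * χ (-1)) / 2 = if χ (-1) = s then 1 else 0 := by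
    intro χ
    have h1 : χ (-1) * χ (-1) = 1 := by rw [← map_mul]; simp
    rcases mul_self_eq_one_iff.1 h1 with h | h <;> rcases hs with rfl | rfl <;> rw [h] <;> norm_num
  have hfull : ∑ χ : DirichletCharacter ℂ N,
      (if χ (-1) = s then χ q * gaussSum χ⁻¹ e' / N else 0)
      = (N.totient : ℂ) / N * ((e (-q) + s * e q) / 2) := by
    have h1 := sum_char_mul_gaussSum_inv hq e'
    have h2 := sum_char_mul_gaussSum_inv hq.neg e'
    have e1 : e' q = e (-q) := by rw [AddChar.mulShift_apply]; simp
    have e2 : e' (-q) = e q := by rw [AddChar.mulShift_apply]; simp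
    rw [e1] at h1
    rw [e2] at h2
    calc _ = ∑ χ : DirichletCharacter ℂ N, (χ q * gaussSum χ⁻¹ e'
          + s * (χ (-q) * gaussSum χ⁻¹ e')) / (2 * N) := by
          refine Finset.sum_congr rfl fun χ _ => ?_
          rw [← boole_mul, ← hsign, ← neg_one_mul q, map_mul]
          ring
      _ = _ := by
          rw [← Finset.sum_div, Finset.sum_add_distrib, ← Finset.mul_sum, h1, h2]
          field_simp
  have hset : ∑ᶠ χ ∈ {χ : DirichletCharacter ℂ N | χ.IsPrimitive ∧ χ (-1) = s}, χ q / tau χ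
      = ∑ χ : DirichletCharacter ℂ N,
        if χ (-1) = s ∧ χ.IsPrimitive then χ q * gaussSum χ⁻¹ e' / N else 0 := by
    rw [finsum_mem_def, finsum_eq_sum_of_fintype]
    refine Finset.sum_congr rfl fun χ _ => ?_
    have hmem : χ ∈ {χ : DirichletCharacter ℂ N | χ.IsPrimitive ∧ χ (-1) = s} ↔
        χ (-1) = s ∧ χ.IsPrimitive := and_comm
    simp only [Set.indicator_apply, hmem]
    split_ifs with h
    · exact hterm χ h.2
    · rfl
  rw [hset, ← hfull, ← Finset.sum_sub_distrib]
  -- Cost of including imprimitive characters: nothing for squarefull `N`, and `1/N` from `χ = 1`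
  -- for prime `N`.
  have hbound : ∀ χ : DirichletCharacter ℂ N,
      ‖(if χ (-1) = s ∧ χ.IsPrimitive then χ q * gaussSum χ⁻¹ e' / N else 0)
        - (if χ (-1) = s then χ q * gaussSum χ⁻¹ e' / N else 0)‖ ≤
          if χ = 1 then 1 / (N : ℝ) else 0 := by
    intro χ
    have hnn : 0 ≤ if χ = 1 then 1 / (N : ℝ) else 0 := by split_ifs <;> positivity
    by_cases h1 : χ (-1) = s
    swap
    · simpa [h1] using hnn
    by_cases h2 : χ.IsPrimitive
    · simpa [h1, h2] using hnn
    simp only [h1, h2, and_false, if_false, if_true, zero_sub, norm_neg]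
    have h2' : ¬ χ⁻¹.IsPrimitive := fun h => h2 (inv_isPrimitive_iff.1 h)
    rcases hN with hN | hN
    · obtain ⟨h3, h4⟩ := gaussSum_of_prime_of_not_isPrimitive hN h2' he'
      rw [h4, if_pos (inv_eq_one.1 h3), inv_eq_one.1 h3, MulChar.one_apply hq]
      simp
    · rw [gaussSum_eq_zero_of_squarefull hN h2' he']
      simpa using hnn
  refine (norm_sum_le_of_le _ fun χ _ => hbound χ).trans ?_
  simp

end Characters
end DirichletMurmuration
namespace DirichletMurmuration

/-! ### Growth of the normalising factor -/

section Denominator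

/-- The `j`-th smallest element is at least `j + 1`, so the product dominates the telescoping `∏
j/(j+1)`. -/
lemma inv_card_add_one_le_prod (s : Finset ℕ) (hs : ∀ p ∈ s, 2 ≤ p) :
    1 / ((s.card : ℝ) + 1) ≤ ∏ p ∈ s, (1 - (p : ℝ)⁻¹) := by
  induction s using Finset.induction_on_max with
  | empty => simp
  | insert a s hmax ih =>
    have ha : a ∉ s := fun h => lt_irrefl _ (hmax a h)
    have hcard : s.card + 2 ≤ a := by
      have h1 : s ⊆ Finset.Ico 2 a := fun p hp =>
        Finset.mem_Ico.2 ⟨hs p (Finset.mem_insert_of_mem hp), hmax p hp⟩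
      have h2 := Finset.card_le_card h1
      have h3 := hs a (Finset.mem_insert_self a s)
      rw [Nat.card_Ico] at h2
      omega
    have hcard' : (s.card : ℝ) + 2 ≤ a := by exact_mod_cast hcard
    rw [Finset.prod_insert ha, Finset.card_insert_of_notMem ha]
    have ih' := ih fun p hp => hs p (Finset.mem_insert_of_mem hp)
    have h1 : (a : ℝ)⁻¹ ≤ ((s.card : ℝ) + 2)⁻¹ := by gcongr
    calc 1 / (((s.card + 1 : ℕ) : ℝ) + 1)
        = (1 - ((s.card : ℝ) + 2)⁻¹) * (1 / ((s.card : ℝ) + 1)) := by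
          push_cast
          field_simp
          ring
      _ ≤ (1 - (a : ℝ)⁻¹) * ∏ p ∈ s, (1 - (p : ℝ)⁻¹) := by
          have h2 : (a : ℝ)⁻¹ ≤ 1 := inv_le_one_of_one_le₀ (by linarith [s.card.cast_nonneg (α := ℝ)])
          gcongr

/-- Since `2 ^ ω(n) ≤ n`, the number of prime factors is at most `log₂ n`. -/
lemma inv_log_add_one_le_totient_div {n : ℕ} (hn : 0 < n) :
    1 / (Real.log n / Real.log 2 + 1) ≤ (n.totient : ℝ) / n := by
  have hn0 : (n : ℝ) ≠ 0 := Nat.cast_ne_zero.2 hn.ne'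
  have h1 : (n.totient : ℝ) / n = ∏ p ∈ n.primeFactors, (1 - (p : ℝ)⁻¹) := by
    have := Nat.totient_eq_mul_prod_factors n
    have h2 : (n.totient : ℝ) = n * ∏ p ∈ n.primeFactors, (1 - (p : ℝ)⁻¹) := by
      have := congrArg ((↑) : ℚ → ℝ) this
      push_cast at this
      exact this
    rw [h2, mul_div_cancel_left₀ _ hn0]
  have h2 : 2 ^ n.primeFactors.card ≤ n :=
    (Finset.pow_card_le_prod _ _ _ fun p hp => (Nat.prime_of_mem_primeFactors hp).two_le).trans
      (Nat.le_of_dvd hn (Nat.prod_primeFactors_dvd n))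
  have h3 : (n.primeFactors.card : ℝ) ≤ Real.log n / Real.log 2 := by
    rw [le_div_iff₀ (Real.log_pos one_lt_two), ← Real.log_pow]
    exact Real.log_le_log (by positivity) (by exact_mod_cast h2)
  rw [h1]
  refine le_trans ?_ (inv_card_add_one_le_prod _ fun p hp =>
    (Nat.prime_of_mem_primeFactors hp).two_le)
  gcongr

lemma sq_mem_S {n : ℕ} (hn : 0 < n) : n ^ 2 ∈ S := by
  refine ⟨by positivity, ?_, Or.inr ⟨by positivity, fun p hp h =>
    pow_dvd_pow_of_dvd (hp.dvd_of_dvd_pow h) 2⟩⟩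
  intro h
  have h1 : n % 4 < 4 := Nat.mod_lt _ (by norm_num)
  rw [Nat.ModEq, Nat.pow_mod] at h
  interval_cases n % 4 <;> simp at h

open Classical in
lemma f_sub_f {X Y : ℝ} (h : X ≤ Y) :
    f Y - f X = ∑ N ∈ (Finset.Ioc ⌊X⌋₊ ⌊Y⌋₊).filter (fun N => N ∈ S), (N.totient : ℝ) / N := by
  have hXY := Nat.floor_mono h
  unfold f
  rw [sub_eq_iff_eq_add, ← Finset.sum_union]
  · congr 1
    ext N
    simp only [Finset.mem_filter, Finset.mem_Icc, Finset.mem_Ioc, Finset.mem_union]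
    constructor
    · rintro ⟨⟨h1, h2⟩, h3⟩
      rcases le_or_gt N ⌊X⌋₊ with h4 | h4
      · exact Or.inr ⟨⟨h1, h4⟩, h3⟩
      · exact Or.inl ⟨⟨h4, h2⟩, h3⟩
    · rintro (⟨⟨h1, h2⟩, h3⟩ | ⟨⟨h1, h2⟩, h3⟩)
      · exact ⟨⟨by omega, h2⟩, h3⟩
      · exact ⟨⟨h1, by omega⟩, h3⟩
  · rw [Finset.disjoint_left]
    intro N h1 h2
    simp only [Finset.mem_filter, Finset.mem_Icc, Finset.mem_Ioc] at h1 h2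
    omega

open Classical in
-- Only the squares in `(X, Y]` are kept; there are at least `√Y - √X - 1` of them.
lemma le_f_sub_f {X Y : ℝ} (hX : 1 ≤ X) (h : X ≤ Y) :
    (√Y - √X - 1) * (1 / (Real.log Y / Real.log 2 + 1)) ≤ f Y - f X := by
  rw [f_sub_f h]
  have hlog2 := Real.log_pos (one_lt_two (α := ℝ))
  have hlogY := Real.log_nonneg (hX.trans h)
  set T := (Finset.Ioc ⌊√X⌋₊ ⌊√Y⌋₊).image (fun n => n ^ 2) with hT
  have hcard : √Y - √X - 1 ≤ (T.card : ℝ) := by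
    rw [hT, Finset.card_image_of_injective _ (Nat.pow_left_injective two_ne_zero), Nat.card_Ioc,
      Nat.cast_sub (Nat.floor_mono (Real.sqrt_le_sqrt h))]
    linarith [Nat.lt_floor_add_one (√Y), Nat.floor_le (Real.sqrt_nonneg X)]
  have hmem : ∀ N ∈ T, 0 < N ∧ X < N ∧ (N : ℝ) ≤ Y ∧ N ∈ S := by
    intro N hN
    rw [hT, Finset.mem_image] at hN
    obtain ⟨n, hn, rfl⟩ := hN
    rw [Finset.mem_Ioc] at hn
    have h1 : √X < n := Nat.lt_of_floor_lt hn.1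
    have h2 : (n : ℝ) ≤ √Y := (Nat.le_floor_iff (Real.sqrt_nonneg _)).1 hn.2
    have hn0 : 0 < n := by omega
    refine ⟨by positivity, ?_, ?_, sq_mem_S hn0⟩
    · push_cast
      exact (Real.sqrt_lt' (by positivity)).1 h1
    · push_cast
      rwa [← Real.le_sqrt (by positivity) (by linarith)]
  calc (√Y - √X - 1) * (1 / (Real.log Y / Real.log 2 + 1))
      ≤ T.card * (1 / (Real.log Y / Real.log 2 + 1)) := by gcongr
    _ ≤ ∑ N ∈ T, (N.totient : ℝ) / N := by
        rw [← nsmul_eq_mul]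
        refine Finset.card_nsmul_le_sum _ _ _ fun N hN => ?_
        obtain ⟨h1, h2, h3, _⟩ := hmem N hN
        have hN0 : (0 : ℝ) < N := Nat.cast_pos.2 h1
        refine le_trans ?_ (inv_log_add_one_le_totient_div h1)
        have : 0 ≤ Real.log N := Real.log_nonneg (by linarith)
        gcongr
    _ ≤ _ := by
        refine Finset.sum_le_sum_of_subset_of_nonneg (fun N hN => ?_) fun N _ _ => by positivity
        obtain ⟨h1, h2, h3, h4⟩ := hmem N hN
        rw [Finset.mem_filter, Finset.mem_Ioc]
        exact ⟨⟨(Nat.floor_lt (by linarith)).2 h2, Nat.le_floor h3⟩, h4⟩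

lemma rpow_le_self {X δ : ℝ} (hX : 1 ≤ X) (hδ : δ ≤ 1) : X ^ δ ≤ X := by
  simpa using Real.rpow_le_rpow_of_exponent_le hX hδ

/-- The normalising factor tends to infinity. -/
theorem tendsto_f_sub_f {δ : ℝ} (hδ : δ ∈ Set.Ioo (1 / 2 : ℝ) 1) :
    Tendsto (fun X : ℝ => f (X + X ^ δ) - f X) atTop atTop := by
  have hlog2 := Real.log_pos (one_lt_two (α := ℝ))
  have ha : 0 < δ - 1 / 2 := by linarith [hδ.1]
  have hpow : Tendsto (fun X : ℝ => X ^ (δ - 1 / 2)) atTop atTop := tendsto_rpow_atTop ha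
  -- Half of the exponent `δ - 1/2` is spent on absorbing the logarithm; the other half gives the
  -- divergence.
  have hsmall : ∀ᶠ X : ℝ in atTop, Real.log X / Real.log 2 + 2 ≤ X ^ ((δ - 1 / 2) / 2) := by
    have h1 : (fun X : ℝ => Real.log X / Real.log 2 + 2) =o[atTop] fun X => X ^ ((δ - 1 / 2) / 2) := by
      refine Asymptotics.IsLittleO.add ?_ ?_
      · simp_rw [div_eq_inv_mul (Real.log _)]
        exact (isLittleO_log_rpow_atTop (by positivity)).const_mul_left _
      · exact Asymptotics.isLittleO_const_left.2 (Or.inr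
          (tendsto_norm_atTop_atTop.comp (tendsto_rpow_atTop (by positivity))))
    filter_upwards [h1.bound one_pos, eventually_ge_atTop 1] with X h2 h3
    rw [one_mul, Real.norm_of_nonneg (Real.rpow_nonneg (by linarith) _)] at h2
    exact (le_abs_self _).trans h2
  have hlow : Tendsto (fun X : ℝ => X ^ ((δ - 1 / 2) / 2) / 6) atTop atTop :=
    (tendsto_rpow_atTop (by positivity)).atTop_div_const (by norm_num)
  refine tendsto_atTop_mono' _ ?_ hlow
  filter_upwards [hsmall, hpow.eventually_ge_atTop 6, eventually_ge_atTop 1] with X h1 h2 h3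
  have hX0 : 0 < X := by linarith
  have hle : X ≤ X + X ^ δ := le_add_of_nonneg_right (by positivity)
  refine le_trans ?_ (le_f_sub_f h3 hle)
  have hXδ := rpow_le_self h3 hδ.2.le
  have hsqrt : X ^ (δ - 1 / 2) / 3 ≤ √(X + X ^ δ) - √X := by
    have e1 : X ^ δ = X ^ (δ - 1 / 2) * √X := by
      rw [Real.sqrt_eq_rpow, ← Real.rpow_add hX0]; congr 1; ring
    have e2 := Real.sq_sqrt hX0.le
    have e3 := Real.sq_sqrt (show 0 ≤ X + X ^ δ by positivity)
    have e4 : √(X + X ^ δ) ≤ 2 * √X := by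
      rw [Real.sqrt_le_left (by positivity), mul_pow, e2]; linarith
    have e5 : (√(X + X ^ δ) - √X) * (√(X + X ^ δ) + √X) = X ^ (δ - 1 / 2) * √X := by
      rw [← e1]; linear_combination e3 - e2
    have e6 : 0 < √X := Real.sqrt_pos.2 hX0
    have e7 : 0 ≤ √(X + X ^ δ) - √X := sub_nonneg.2 (Real.sqrt_le_sqrt hle)
    have e8 : X ^ (δ - 1 / 2) * √X ≤ (√(X + X ^ δ) - √X) * 3 * √X := by
      rw [← e5, mul_assoc]; gcongr; linarith
    have := le_of_mul_le_mul_right e8 e6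
    linarith
  have hlogY : Real.log (X + X ^ δ) / Real.log 2 + 1 ≤ Real.log X / Real.log 2 + 2 := by
    have : Real.log (X + X ^ δ) ≤ Real.log 2 + Real.log X := by
      rw [← Real.log_mul two_ne_zero hX0.ne']
      exact Real.log_le_log (by positivity) (by linarith)
    have h4 : Real.log (X + X ^ δ) / Real.log 2 ≤ (Real.log 2 + Real.log X) / Real.log 2 := by gcongr
    rw [add_div, div_self hlog2.ne'] at h4
    linarith
  have hlogX := Real.log_nonneg h3
  have hlogY0 := Real.log_nonneg (h3.trans hle)
  set u := X ^ ((δ - 1 / 2) / 2) with hu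
  have hu0 : 0 < u := by positivity
  have huu : X ^ (δ - 1 / 2) = u * u := by
    rw [hu, ← Real.rpow_add hX0]; congr 1; ring
  rw [huu] at hsqrt h2
  calc u / 6 = (u * u / 6) * (1 / u) := by field_simp
    _ ≤ (√(X + X ^ δ) - √X - 1) * (1 / (Real.log (X + X ^ δ) / Real.log 2 + 1)) := by
        gcongr
        · linarith
        · linarith
        · linarith

end Denominator
end DirichletMurmuration
namespace DirichletMurmuration

/-! ### Boundary behaviour of `-ζ'/ζ - ζ` on `Re s = 1` -/

section ZetaAux

open DirichletCharacter ArithmeticFunction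

/-- The continuous extension to `1 ≤ Re s` of `-ζ'/ζ(s) - ζ(s)`. -/
noncomputable def zetaAux (s : ℂ) : ℂ :=
  -deriv (LFunctionTrivChar₁ 1) s / LFunctionTrivChar₁ 1 s - dslope (LFunctionTrivChar₁ 1) 1 s

lemma LFunctionTrivChar_one : LFunctionTrivChar 1 = riemannZeta := LFunction_modOne_eq

/-- The poles at `1` cancel: with `F(s) = (s-1)ζ(s)` entire, both `-F'/F` and the difference
quotient of `F` at `1` are continuous, the former by nonvanishing of `ζ` on `Re s ≥ 1`. -/
lemma continuousOn_zetaAux : ContinuousOn zetaAux {s : ℂ | 1 ≤ s.re} := by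
  refine ContinuousOn.sub ((continuousOn_neg_logDeriv_LFunctionTrivChar₁ 1).mono ?_) ?_
  · intro s hs
    rw [LFunctionTrivChar_one]
    exact Or.inr (riemannZeta_ne_zero_of_one_le_re hs)
  · have h := differentiable_LFunctionTrivChar₁ 1
    refine Continuous.continuousOn (continuous_iff_continuousAt.2 fun s => ?_)
    by_cases hs : s = 1
    · rw [hs, continuousAt_dslope_same]; exact h 1
    · rw [continuousAt_dslope_of_ne hs]; exact (h s).continuousAt

lemma zetaAux_eq {s : ℂ} (hs : 1 < s.re) :
    zetaAux s = -deriv riemannZeta s / riemannZeta s - riemannZeta s := by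
  have hs1 : s ≠ 1 := by rintro rfl; simp at hs
  have hs1' : s - 1 ≠ 0 := sub_ne_zero.2 hs1
  have hz : riemannZeta s ≠ 0 := riemannZeta_ne_zero_of_one_le_re hs.le
  have h1 : LFunctionTrivChar₁ 1 1 = 1 := by simp [LFunctionTrivChar₁]
  have h2 : LFunctionTrivChar₁ 1 s = (s - 1) * riemannZeta s := by
    rw [LFunctionTrivChar₁, Function.update_of_ne hs1, LFunctionTrivChar_one]
  have hslope : dslope (LFunctionTrivChar₁ 1) 1 s = riemannZeta s - 1 / (s - 1) := by
    rw [dslope_of_ne _ hs1, slope_def_field, h1, h2]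
    field_simp
  rw [zetaAux, hslope, deriv_LFunctionTrivChar₁_apply_of_ne_one 1 hs1, h2, LFunctionTrivChar_one]
  field_simp
  ring

lemma LSeriesHasSum_zetaAux {s : ℂ} (hs : 1 < s.re) :
    LSeriesHasSum (fun n => ((Λ n - 1 : ℝ) : ℂ)) s (zetaAux s) := by
  have h1 := (LSeriesSummable_vonMangoldt hs).LSeriesHasSum
  have h2 := (LSeriesSummable_one_iff.2 hs).LSeriesHasSum
  rw [LSeries_vonMangoldt_eq_deriv_riemannZeta_div hs] at h1
  rw [LSeries_one_eq_riemannZeta hs] at h2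
  rw [zetaAux_eq hs]
  convert! h1.sub h2 using 1
  ext n
  simp

end ZetaAux

/-! ### Bounds for the Fejér kernel -/

section Kernel

/-- The Fejér kernel, as a cosine transform of the triangle function on `[0, l]`. -/
noncomputable def fejer (l u : ℝ) : ℝ := ∫ t in (0 : ℝ)..l, (1 - t / l) * Real.cos (t * u)

lemma fejer_eq {l u : ℝ} (hl : 0 < l) (hu : u ≠ 0) :
    fejer l u = (1 - Real.cos (l * u)) / (l * u ^ 2) := by
  have hd : ∀ t ∈ Set.uIcc 0 l, HasDerivAt
      (fun t : ℝ => (1 - t / l) * (Real.sin (t * u) / u) - Real.cos (t * u) / (l * u ^ 2))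
      ((1 - t / l) * Real.cos (t * u)) t := by
    intro t _
    have h1 : HasDerivAt (fun t : ℝ => t * u) u t := by simpa using (hasDerivAt_id t).mul_const u
    have h2 : HasDerivAt (fun t : ℝ => 1 - t / l) (-(1 / l)) t := by
      simpa using ((hasDerivAt_id t).div_const l).const_sub 1
    have h3 := (h1.sin.div_const u)
    have h4 := (h1.cos.div_const (l * u ^ 2))
    convert! (h2.mul h3).sub h4 using 1
    field_simp
    ring
  rw [fejer, intervalIntegral.integral_eq_sub_of_hasDerivAt hd
    (Continuous.intervalIntegrable (by fun_prop) _ _)]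
  have := hl.ne'
  simp
  field_simp
  ring

lemma integral_triangle {l : ℝ} (hl : 0 < l) : ∫ t in (0 : ℝ)..l, (1 - t / l) = l / 2 := by
  have := hl.ne'
  rw [intervalIntegral.integral_sub (by simp) (Continuous.intervalIntegrable (by fun_prop) _ _)]
  simp
  field_simp
  ring

lemma fejer_zero {l : ℝ} (hl : 0 < l) : fejer l 0 = l / 2 := by
  simpa [fejer] using integral_triangle hl

lemma fejer_nonneg {l : ℝ} (hl : 0 < l) (u : ℝ) : 0 ≤ fejer l u := by
  by_cases hu : u = 0
  · rw [hu, fejer_zero hl]; positivity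
  · rw [fejer_eq hl hu]
    have := Real.cos_le_one (l * u)
    exact div_nonneg (by linarith) (by positivity)

lemma fejer_le {l : ℝ} (hl : 0 < l) (u : ℝ) : fejer l u ≤ l / 2 := by
  rw [← integral_triangle hl]
  refine intervalIntegral.integral_mono_on hl.le (Continuous.intervalIntegrable (by fun_prop) _ _)
    (Continuous.intervalIntegrable (by fun_prop) _ _) fun t ht => ?_
  have h1 : 0 ≤ 1 - t / l := by rw [sub_nonneg, div_le_one hl]; exact ht.2
  nlinarith [Real.cos_le_one (t * u)]

lemma fejer_le_div {l u : ℝ} (hl : 0 < l) (hu : u ≠ 0) : fejer l u ≤ 2 / (l * u ^ 2) := by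
  rw [fejer_eq hl hu]
  gcongr
  linarith [Real.neg_one_le_cos (l * u)]

lemma le_fejer {l u : ℝ} (hl : 0 < l) (hu : |u| ≤ 1 / l) : l / 4 ≤ fejer l u := by
  have h : ∫ t in (0 : ℝ)..l, (1 - t / l) * (1 / 2) = l / 4 := by
    rw [intervalIntegral.integral_mul_const, integral_triangle hl]; ring
  rw [← h]
  refine intervalIntegral.integral_mono_on hl.le (Continuous.intervalIntegrable (by fun_prop) _ _)
    (Continuous.intervalIntegrable (by fun_prop) _ _) fun t ht => ?_
  have h1 : 0 ≤ 1 - t / l := by rw [sub_nonneg, div_le_one hl]; exact ht.2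
  have h2 : |t * u| ≤ 1 := by
    rw [abs_mul, abs_of_nonneg ht.1]
    calc t * |u| ≤ l * (1 / l) := by gcongr; exact ht.2
      _ = 1 := by field_simp
  have h3 := Real.one_sub_sq_div_two_le_cos (x := t * u)
  have h4 : (t * u) ^ 2 ≤ 1 := by rw [← sq_abs]; nlinarith [abs_nonneg (t * u)]
  have h5 : 1 / 2 ≤ Real.cos (t * u) := by linarith
  gcongr

/-- A majorant with quadratic decay, used to dominate the kernel sums for fixed `l`. -/
lemma fejer_le_majorant {l : ℝ} (hl : 0 < l) (u : ℝ) :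
    fejer l u ≤ (l / 2 + 2 / l) * (1 / (1 + u ^ 2)) := by
  rw [mul_one_div, le_div_iff₀ (by positivity), mul_add, mul_one]
  refine add_le_add (fejer_le hl u) ?_
  by_cases hu : u = 0
  · rw [hu]; simp; positivity
  · calc fejer l u * u ^ 2 ≤ 2 / (l * u ^ 2) * u ^ 2 := by gcongr; exact fejer_le_div hl hu
      _ = 2 / l := by field_simp

/-- Away from the centre the constant is `O(1/l)` for fixed `η`, so a large `l` concentrates the
kernel. -/
lemma fejer_le_of_le_abs {l η u : ℝ} (hl : 0 < l) (hη : 0 < η) (hη1 : η ≤ 1) (hu : η ≤ |u|) :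
    fejer l u ≤ 4 / (l * η ^ 2) * (1 / (1 + u ^ 2)) := by
  have hu0 : u ≠ 0 := by rintro rfl; simp at hu; linarith
  refine (fejer_le_div hl hu0).trans ?_
  have h1 : η ^ 2 ≤ u ^ 2 := by rw [← sq_abs u]; gcongr
  rw [div_mul_div_comm, mul_one, div_le_div_iff₀ (by positivity) (by positivity)]
  have h2 : η ^ 2 * (1 + u ^ 2) ≤ 2 * u ^ 2 := by
    have : η ^ 2 ≤ 1 := by nlinarith
    nlinarith [sq_nonneg u]
  nlinarith

end Kernel

/-! ### Chebyshev-type sums on a logarithmic scale -/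

section Windows

lemma summable_inv_one_add_sq_int : Summable fun k : ℤ => 1 / (1 + (k : ℝ) ^ 2) := by
  refine Summable.of_norm_bounded_eventually
    (Real.summable_one_div_int_pow.2 (one_lt_two : 1 < 2)) ?_
  have : ∀ᶠ k : ℤ in cofinite, k ≠ 0 :=
    (Set.finite_singleton (0 : ℤ)).eventually_cofinite_notMem
  filter_upwards [this] with k hk
  have : (k : ℝ) ≠ 0 := by exact_mod_cast hk
  rw [Real.norm_of_nonneg (by positivity)]
  gcongr
  linarith

/-- A constant bounding `∑ b(n) / (n (1 + log² (n / x)))` for sequences of Chebyshev type. -/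
noncomputable def windowConst : ℝ := 3 * Real.exp 1 * ∑' k : ℤ, 1 / (1 + (k : ℝ) ^ 2)

lemma windowConst_nonneg : 0 ≤ windowConst := by
  unfold windowConst
  have : 0 ≤ ∑' k : ℤ, 1 / (1 + (k : ℝ) ^ 2) := tsum_nonneg fun k => by positivity
  positivity

/-- Split into blocks `j ≤ log(n/x) < j + 1`: the linear bound on partial sums makes each block
contribute `O(C)` to `∑ b n / n`, and the weight there is `O(1/(1 + j²))`. -/
lemma sum_window_le {b : ℕ → ℝ} (hb : ∀ n, 0 ≤ b n) {C : ℝ} (hC : 0 ≤ C)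
    (hbC : ∀ y : ℝ, 0 ≤ y → ∑ n ∈ Finset.Ioc 0 ⌊y⌋₊, b n ≤ C * y) {x : ℝ} (hx : 0 < x)
    (s : Finset ℕ) :
    ∑ n ∈ s, b n / n * (1 / (1 + (Real.log n - Real.log x) ^ 2)) ≤ C * windowConst := by
  classical
  set s' := s.filter (0 < ·) with hs'
  have h0 : ∑ n ∈ s, b n / n * (1 / (1 + (Real.log n - Real.log x) ^ 2))
      = ∑ n ∈ s', b n / n * (1 / (1 + (Real.log n - Real.log x) ^ 2)) := by
    rw [hs', Finset.sum_filter_of_ne]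
    intro n _ h
    rcases Nat.eq_zero_or_pos n with rfl | h'
    · simp at h
    · exact h'
  rw [h0]
  set k : ℕ → ℤ := fun n => ⌊Real.log n - Real.log x⌋ with hk
  rw [← Finset.sum_fiberwise_of_maps_to (t := s'.image k) (g := k)
    fun n hn => Finset.mem_image_of_mem k hn]
  have hfib : ∀ j ∈ s'.image k, ∑ n ∈ s' with k n = j,
      b n / n * (1 / (1 + (Real.log n - Real.log x) ^ 2))
      ≤ C * (3 * Real.exp 1) * (1 / (1 + (j : ℝ) ^ 2)) := by
    intro j _
    have hxe : 0 < x * Real.exp j := by positivity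
    calc ∑ n ∈ s' with k n = j, b n / n * (1 / (1 + (Real.log n - Real.log x) ^ 2))
        ≤ ∑ n ∈ s' with k n = j, b n / (x * Real.exp j) * (3 / (1 + (j : ℝ) ^ 2)) := by
          refine Finset.sum_le_sum fun n hn => ?_
          simp only [hs', Finset.mem_filter] at hn
          obtain ⟨⟨_, hn0⟩, hkn⟩ := hn
          have hn0' : (0 : ℝ) < n := Nat.cast_pos.2 hn0
          rw [hk, Int.floor_eq_iff] at hkn
          have h1 : x * Real.exp j ≤ n := by
            rw [← Real.log_le_log_iff hxe hn0', Real.log_mul hx.ne' (Real.exp_ne_zero _),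
              Real.log_exp]
            linarith
          have := hb n
          gcongr ?_ * ?_
          · gcongr
          · rw [div_le_div_iff₀ (by positivity) (by positivity)]
            have h2 := hkn.1
            have h3 := hkn.2
            set u := Real.log n - Real.log x
            -- As `0 ≤ u - j < 1`, `j² ≤ 2u² + 2`, whence the constant `3`.
            nlinarith [sq_nonneg (u + (u - j)), sq_nonneg u,
              mul_nonneg (sub_nonneg.2 h2) (by linarith : 0 ≤ 1 - (u - j))]
      _ = (∑ n ∈ s' with k n = j, b n) * (1 / (x * Real.exp j) * (3 / (1 + (j : ℝ) ^ 2))) := by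
          rw [Finset.sum_mul]
          exact Finset.sum_congr rfl fun n _ => by ring
      _ ≤ (C * (x * Real.exp (j + 1))) * (1 / (x * Real.exp j) * (3 / (1 + (j : ℝ) ^ 2))) := by
          gcongr
          refine le_trans ?_ (hbC (x * Real.exp (j + 1)) (by positivity))
          refine Finset.sum_le_sum_of_subset_of_nonneg ?_ fun n _ _ => hb n
          intro n hn
          simp only [hs', Finset.mem_filter] at hn
          obtain ⟨⟨_, hn0⟩, hkn⟩ := hn
          have hn0' : (0 : ℝ) < n := Nat.cast_pos.2 hn0
          rw [hk, Int.floor_eq_iff] at hkn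
          rw [Finset.mem_Ioc]
          refine ⟨hn0, Nat.le_floor ?_⟩
          rw [← Real.log_le_log_iff hn0' (by positivity), Real.log_mul hx.ne' (Real.exp_ne_zero _),
              Real.log_exp]
          linarith
      _ = _ := by
          rw [Real.exp_add]
          have := (Real.exp_pos j).ne'
          field_simp
  refine (Finset.sum_le_sum hfib).trans ?_
  rw [← Finset.mul_sum, windowConst]
  have := summable_inv_one_add_sq_int.sum_le_tsum (s'.image k) fun j _ => by positivity
  calc _ ≤ C * (3 * Real.exp 1) * ∑' k : ℤ, 1 / (1 + (k : ℝ) ^ 2) := by gcongr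
    _ = _ := by ring

lemma summable_window {b : ℕ → ℝ} (hb : ∀ n, 0 ≤ b n) {C : ℝ} (hC : 0 ≤ C)
    (hbC : ∀ y : ℝ, 0 ≤ y → ∑ n ∈ Finset.Ioc 0 ⌊y⌋₊, b n ≤ C * y) {x : ℝ} (hx : 0 < x) :
    Summable fun n : ℕ => b n / n * (1 / (1 + (Real.log n - Real.log x) ^ 2)) :=
  summable_of_sum_le (fun n => by have := hb n; positivity) (sum_window_le hb hC hbC hx)

lemma tsum_window_le {b : ℕ → ℝ} (hb : ∀ n, 0 ≤ b n) {C : ℝ} (hC : 0 ≤ C)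
    (hbC : ∀ y : ℝ, 0 ≤ y → ∑ n ∈ Finset.Ioc 0 ⌊y⌋₊, b n ≤ C * y) {x : ℝ} (hx : 0 < x) :
    ∑' n : ℕ, b n / n * (1 / (1 + (Real.log n - Real.log x) ^ 2)) ≤ C * windowConst :=
  (summable_window hb hC hbC hx).tsum_le_of_sum_le (sum_window_le hb hC hbC hx)

end Windows
end DirichletMurmuration
namespace DirichletMurmuration

/-! ### Comparing `Λ` with `1` against the Fejér kernel -/

section Tauberian

open ArithmeticFunction MeasureTheory

/-- The cosine transform of `-ζ'/ζ - ζ` on the line `Re s = σ`, weighted by a triangle. -/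
noncomputable def zetaAuxTransform (l σ x : ℝ) : ℂ :=
  ∫ t in (0 : ℝ)..l, ((1 - t / l : ℝ) : ℂ) *
    (zetaAux (σ + t * Complex.I) * Complex.exp (t * Real.log x * Complex.I))

lemma continuous_zetaAux_line {σ : ℝ} (hσ : 1 ≤ σ) :
    Continuous fun t : ℝ => zetaAux (σ + t * Complex.I) :=
  continuousOn_zetaAux.comp_continuous (by fun_prop) fun t => by simpa using hσ

lemma term_mul_exp {n : ℕ} (a : ℕ → ℂ) (σ t x : ℝ) :
    LSeries.term a (σ + t * Complex.I) n * Complex.exp (t * Real.log x * Complex.I)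
      = LSeries.term a σ n * Complex.exp (-(t * (Real.log n - Real.log x) : ℝ) * Complex.I) := by
  rcases Nat.eq_zero_or_pos n with rfl | hn
  · simp
  have hn0 : (n : ℂ) ≠ 0 := Nat.cast_ne_zero.2 hn.ne'
  rw [LSeries.term_of_ne_zero hn.ne', LSeries.term_of_ne_zero hn.ne', Complex.cpow_add _ _ hn0,
    Complex.cpow_def_of_ne_zero hn0 (t * Complex.I), ← Complex.natCast_log, ← div_div,
    div_mul_eq_mul_div,
    mul_div_assoc, ← Complex.exp_sub]
  congr 2
  push_cast
  ring

lemma re_integral_cos (l u : ℝ) :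
    (∫ t in (0 : ℝ)..l, ((1 - t / l : ℝ) : ℂ) *
      Complex.exp (-(t * u : ℝ) * Complex.I)).re = fejer l u := by
  have := Complex.reCLM.intervalIntegral_comp_comm (μ := volume) (a := 0) (b := l)
    (f := fun t : ℝ => ((1 - t / l : ℝ) : ℂ) * Complex.exp (-(t * u : ℝ) * Complex.I))
    (Continuous.intervalIntegrable (by fun_prop) _ _)
  rw [Complex.reCLM_apply] at this
  rw [← this, fejer]
  refine intervalIntegral.integral_congr fun t _ => ?_
  simp only [Complex.reCLM_apply, Complex.re_ofReal_mul]
  rw [← Complex.ofReal_neg, Complex.exp_ofReal_mul_I_re, Real.cos_neg]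

/-- For `σ > 1` absolute convergence allows termwise integration; the phase `(x/n)^(it)` integrates
against the triangle to a number with real part `fejer`. -/
lemma hasSum_fejer {l σ x : ℝ} (hl : 0 < l) (hσ : 1 < σ) :
    HasSum (fun n : ℕ => (Λ n - 1) * (n : ℝ) ^ (-σ) * fejer l (Real.log n - Real.log x))
      (zetaAuxTransform l σ x).re := by
  set a : ℕ → ℂ := fun n => ((Λ n - 1 : ℝ) : ℂ) with ha
  have hsum : ∀ t : ℝ, HasSum (fun n => ((1 - t / l : ℝ) : ℂ) *
      (LSeries.term a (σ + t * Complex.I) n * Complex.exp (t * Real.log x * Complex.I)))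
      (((1 - t / l : ℝ) : ℂ) *
        (zetaAux (σ + t * Complex.I) * Complex.exp (t * Real.log x * Complex.I))) := fun t =>
    ((LSeriesHasSum_zetaAux (by simpa using hσ)).mul_right _).mul_left _
  have habs : Summable fun n => ‖LSeries.term a σ n‖ :=
    (LSeriesHasSum_zetaAux (s := σ) (by simpa using hσ)).LSeriesSummable.norm
  have hterm : ∀ n : ℕ, LSeries.term a σ n = (((Λ n - 1) * (n : ℝ) ^ (-σ) : ℝ) : ℂ) := by
    intro n
    rcases Nat.eq_zero_or_pos n with rfl | hn
    · rw [LSeries.term_zero, Nat.cast_zero, Real.zero_rpow (by linarith)]; simp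
    · rw [LSeries.term_of_ne_zero hn.ne', Real.rpow_neg (Nat.cast_nonneg n), Complex.ofReal_mul,
        Complex.ofReal_inv, Complex.ofReal_cpow (Nat.cast_nonneg n), div_eq_mul_inv]
      rfl
  have hmain := intervalIntegral.hasSum_integral_of_dominated_convergence (μ := volume)
    (a := 0) (b := l)
    (F := fun n t => ((1 - t / l : ℝ) : ℂ) * (LSeries.term a (σ + t * Complex.I) n *
      Complex.exp (t * Real.log x * Complex.I)))
    (f := fun t => ((1 - t / l : ℝ) : ℂ) *
        (zetaAux (σ + t * Complex.I) * Complex.exp (t * Real.log x * Complex.I)))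
    (fun n _ => ‖LSeries.term a σ n‖) ?_ ?_ ?_ ?_ ?_
  · have hre := Complex.hasSum_re hmain
    convert! hre using 1
    ext n
    simp_rw [term_mul_exp, hterm, mul_left_comm (((1 - _ / l : ℝ)) : ℂ)]
    rw [intervalIntegral.integral_const_mul, Complex.re_ofReal_mul, re_integral_cos]
  · intro n
    simp_rw [term_mul_exp]
    exact Continuous.aestronglyMeasurable (by fun_prop)
  · intro n
    refine Eventually.of_forall fun t ht => ?_
    rw [Set.uIoc_of_le hl.le] at ht
    simp only [term_mul_exp]
    rw [norm_mul, norm_mul, ← Complex.ofReal_neg, Complex.norm_exp_ofReal_mul_I, mul_one,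
      Complex.norm_real, Real.norm_eq_abs, abs_of_nonneg]
    · refine mul_le_of_le_one_left (norm_nonneg _) ?_
      rw [sub_le_self_iff]
      exact div_nonneg ht.1.le hl.le
    · rw [sub_nonneg, div_le_one hl]; exact ht.2
  · exact Eventually.of_forall fun t _ => habs
  · exact intervalIntegrable_const
  · exact Eventually.of_forall fun t _ => hsum t

lemma tendsto_zetaAuxTransform {l : ℝ} (hl : 0 < l) (x : ℝ) :
    Tendsto (fun σ => zetaAuxTransform l σ x) (𝓝[>] 1) (𝓝 (zetaAuxTransform l 1 x)) := by
  obtain ⟨B, hB⟩ := ((isCompact_Icc (a := (1 : ℝ)) (b := 2)).prod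
    (isCompact_Icc (a := 0) (b := l))).exists_bound_of_continuousOn
    (f := fun p : ℝ × ℝ => zetaAux (p.1 + p.2 * Complex.I))
    (continuousOn_zetaAux.comp (by fun_prop) fun p hp => by simpa using hp.1.1)
  refine intervalIntegral.tendsto_integral_filter_of_dominated_convergence (fun _ => B) ?_ ?_ ?_ ?_
  · filter_upwards [self_mem_nhdsWithin] with σ hσ
    have := continuous_zetaAux_line (le_of_lt hσ)
    exact Continuous.aestronglyMeasurable (by fun_prop)
  · filter_upwards [Ioo_mem_nhdsGT (one_lt_two (α := ℝ))] with σ hσ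
    refine Eventually.of_forall fun t ht => ?_
    rw [Set.uIoc_of_le hl.le] at ht
    rw [norm_mul, norm_mul, ← Complex.ofReal_mul, Complex.norm_exp_ofReal_mul_I, mul_one,
      Complex.norm_real, Real.norm_eq_abs, abs_of_nonneg]
    · refine (mul_le_of_le_one_left (norm_nonneg _) ?_).trans
        (hB (σ, t) ⟨⟨hσ.1.le, hσ.2.le⟩, ht.1.le, ht.2⟩)
      rw [sub_le_self_iff]
      exact div_nonneg ht.1.le hl.le
    · rw [sub_nonneg, div_le_one hl]; exact ht.2
  · exact intervalIntegrable_const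
  · refine Eventually.of_forall fun t _ => ?_
    refine Tendsto.const_mul _ (Tendsto.mul_const _ ?_)
    have h1 := continuousOn_zetaAux ((1 : ℝ) + t * Complex.I) (by simp)
    refine h1.tendsto.comp (tendsto_nhdsWithin_iff.2 ⟨?_, ?_⟩)
    · exact (Continuous.tendsto (f := fun σ : ℝ => (σ : ℂ) + t * Complex.I) (by fun_prop) 1).mono_left
        nhdsWithin_le_nhds
    · filter_upwards [self_mem_nhdsWithin] with σ hσ
      simpa using le_of_lt hσ

/-- Riemann-Lebesgue at frequency `-log x / (2π)`, applied to the triangle-weighted boundary values.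
-/
lemma tendsto_zetaAuxTransform_atTop {l : ℝ} (hl : 0 < l) :
    Tendsto (fun x => zetaAuxTransform l 1 x) atTop (𝓝 0) := by
  set g : ℝ → ℂ := (Set.Ioc 0 l).indicator
    fun t => ((1 - t / l : ℝ) : ℂ) * zetaAux ((1 : ℝ) + t * Complex.I) with hg
  have h := Real.tendsto_integral_exp_smul_cocompact g
  have h2 : Tendsto (fun x : ℝ => -(Real.log x / (2 * Real.pi))) atTop (cocompact ℝ) := by
    rw [cocompact_eq_atBot_atTop]
    refine Tendsto.mono_right ?_ le_sup_left
    exact tendsto_neg_atTop_atBot.comp (Real.tendsto_log_atTop.atTop_div_const (by positivity))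
  refine (h.comp h2).congr fun x => ?_
  rw [Function.comp_apply, zetaAuxTransform, intervalIntegral.integral_of_le hl.le,
    ← integral_indicator measurableSet_Ioc]
  refine integral_congr_ae (Eventually.of_forall fun t => ?_)
  simp only [hg]
  by_cases ht : t ∈ Set.Ioc 0 l
  · rw [Set.indicator_of_mem ht, Set.indicator_of_mem ht, Circle.smul_def, Real.fourierChar_apply,
      smul_eq_mul, mul_comm, mul_assoc]
    congr 3
    have := Real.pi_ne_zero
    push_cast
    field_simp
  · rw [Set.indicator_of_notMem ht, Set.indicator_of_notMem ht, smul_zero]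

lemma sum_vonMangoldt_le (y : ℝ) (hy : 0 ≤ y) :
    ∑ n ∈ Finset.Ioc 0 ⌊y⌋₊, Λ n ≤ (Real.log 4 + 4) * y := Chebyshev.psi_le_const_mul_self hy

lemma log_four_add_four_pos : 0 < Real.log 4 + 4 := by
  have := Real.log_pos (by norm_num : (1 : ℝ) < 4)
  linarith

lemma summable_vonMangoldt_window {x : ℝ} (hx : 0 < x) :
    Summable fun n : ℕ => Λ n / n * (1 / (1 + (Real.log n - Real.log x) ^ 2)) :=
  summable_window (fun _ => vonMangoldt_nonneg) log_four_add_four_pos.le sum_vonMangoldt_le hx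

lemma tsum_vonMangoldt_window_le {x : ℝ} (hx : 0 < x) :
    ∑' n : ℕ, Λ n / n * (1 / (1 + (Real.log n - Real.log x) ^ 2))
      ≤ (Real.log 4 + 4) * windowConst :=
  tsum_window_le (fun _ => vonMangoldt_nonneg) log_four_add_four_pos.le sum_vonMangoldt_le hx

lemma summable_one_window {x : ℝ} (hx : 0 < x) :
    Summable fun n : ℕ => 1 / (n : ℝ) * (1 / (1 + (Real.log n - Real.log x) ^ 2)) :=
  summable_window (b := fun _ => 1) (fun _ => zero_le_one) zero_le_one
    (fun y hy => by simpa using Nat.floor_le hy) hx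

lemma summable_vonMangoldt_fejer {l x : ℝ} (hl : 0 < l) (hx : 0 < x) :
    Summable fun n : ℕ => Λ n / n * fejer l (Real.log n - Real.log x) := by
  refine Summable.of_nonneg_of_le (fun n => ?_) (fun n => ?_)
    ((summable_vonMangoldt_window hx).mul_left (l / 2 + 2 / l))
  · have := fejer_nonneg hl (Real.log n - Real.log x)
    have : 0 ≤ Λ n := vonMangoldt_nonneg
    positivity
  · rw [mul_left_comm]
    have : 0 ≤ Λ n := vonMangoldt_nonneg
    exact mul_le_mul_of_nonneg_left (fejer_le_majorant hl _) (by positivity)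

lemma summable_one_fejer {l x : ℝ} (hl : 0 < l) (hx : 0 < x) :
    Summable fun n : ℕ => 1 / (n : ℝ) * fejer l (Real.log n - Real.log x) := by
  refine Summable.of_nonneg_of_le (fun n => ?_) (fun n => ?_)
    ((summable_one_window hx).mul_left (l / 2 + 2 / l))
  · have := fejer_nonneg hl (Real.log n - Real.log x)
    positivity
  · rw [mul_left_comm]
    exact mul_le_mul_of_nonneg_left (fejer_le_majorant hl _) (by positivity)

/-- Let `σ → 1⁺` in `hasSum_fejer`; the `σ = 1` series, summable by the window bounds, dominate. -/
lemma tsum_fejer_sub_tsum_fejer {l x : ℝ} (hl : 0 < l) (hx : 0 < x) :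
    ∑' n : ℕ, Λ n / n * fejer l (Real.log n - Real.log x)
      - ∑' n : ℕ, 1 / (n : ℝ) * fejer l (Real.log n - Real.log x)
      = (zetaAuxTransform l 1 x).re := by
  rw [← (summable_vonMangoldt_fejer hl hx).tsum_sub (summable_one_fejer hl hx)]
  have h1 : Tendsto (fun σ => (zetaAuxTransform l σ x).re) (𝓝[>] 1)
      (𝓝 (zetaAuxTransform l 1 x).re) :=
    (Complex.continuous_re.tendsto _).comp (tendsto_zetaAuxTransform hl x)
  refine tendsto_nhds_unique (Tendsto.congr' (f₁ := fun σ =>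
    ∑' n : ℕ, (Λ n - 1) * (n : ℝ) ^ (-σ) * fejer l (Real.log n - Real.log x)) ?_ ?_) h1
  · filter_upwards [self_mem_nhdsWithin] with σ hσ
    exact (hasSum_fejer hl hσ).tsum_eq
  · refine tendsto_tsum_of_dominated_convergence
      ((summable_vonMangoldt_fejer hl hx).add (summable_one_fejer hl hx)) ?_ ?_
    · intro n
      have h2 : Λ n / n * fejer l (Real.log n - Real.log x)
          - 1 / (n : ℝ) * fejer l (Real.log n - Real.log x)
          = (Λ n - 1) * (n : ℝ) ^ (-1 : ℝ) * fejer l (Real.log n - Real.log x) := by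
        rw [Real.rpow_neg_one]; ring
      rw [h2]
      refine Tendsto.mul_const _ (Tendsto.const_mul _ ?_)
      refine Tendsto.mono_left ?_ nhdsWithin_le_nhds
      refine ContinuousAt.tendsto (f := fun σ : ℝ => (n : ℝ) ^ (-σ)) ?_
      rcases Nat.eq_zero_or_pos n with rfl | hn
      -- `0 ^ (-σ)` is `0` except at `σ = 0`, which is away from `1`.
      · refine ContinuousAt.congr (f := fun _ => (0 : ℝ)) continuousAt_const ?_
        filter_upwards [isOpen_ne.mem_nhds (one_ne_zero (α := ℝ))] with σ hσ
        rw [Nat.cast_zero, Real.zero_rpow (neg_ne_zero.2 hσ)]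
      · exact (Real.continuousAt_const_rpow (Nat.cast_ne_zero.2 hn.ne')).comp continuousAt_neg
    · filter_upwards [self_mem_nhdsWithin] with σ hσ n
      have hσ : 1 < σ := hσ
      have hk := fejer_nonneg hl (Real.log n - Real.log x)
      have hL : 0 ≤ Λ n := vonMangoldt_nonneg
      have hp : (n : ℝ) ^ (-σ) ≤ 1 / n := by
        rcases Nat.eq_zero_or_pos n with rfl | hn
        · rw [Nat.cast_zero, Real.zero_rpow (by linarith)]; simp
        · rw [one_div, ← Real.rpow_neg_one]
          exact Real.rpow_le_rpow_of_exponent_le (by exact_mod_cast hn) (by linarith)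
      rw [norm_mul, norm_mul, Real.norm_of_nonneg hk,
        Real.norm_of_nonneg (Real.rpow_nonneg (Nat.cast_nonneg n) _), ← add_mul]
      refine mul_le_mul_of_nonneg_right ?_ hk
      calc ‖Λ n - 1‖ * (n : ℝ) ^ (-σ) ≤ (Λ n + 1) * (1 / n) := by
            gcongr
            · rw [Real.norm_eq_abs, abs_le]; constructor <;> linarith
        _ = _ := by ring

end Tauberian
end DirichletMurmuration
namespace DirichletMurmuration

/-! ### Primes in short multiplicative windows -/

section PrimeGaps

open ArithmeticFunction

lemma summable_nonprime_vonMangoldt_div :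
    Summable fun n : ℕ => if n.Prime then 0 else Λ n / n := by
  refine (vonMangoldt.summable_residueClass_non_primes_div (0 : ZMod 1)).congr fun n => ?_
  have : vonMangoldt.residueClass (0 : ZMod 1) n = Λ n :=
    Set.indicator_of_mem (s := {n : ℕ | (n : ZMod 1) = 0}) (Subsingleton.elim _ _) _
  rw [this]
  split_ifs <;> simp

lemma tendsto_tail_nonprime :
    Tendsto (fun y : ℝ => ∑' n : ℕ, if y ≤ n then (if n.Prime then 0 else Λ n / n) else 0)
      atTop (𝓝 0) := by
  suffices h : Tendsto (fun y : ℝ => ∑' n : ℕ, if y ≤ n then (if n.Prime then 0 else Λ n / n) else 0)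
      atTop (𝓝 (∑' _ : ℕ, 0)) by rwa [tsum_zero] at h
  refine tendsto_tsum_of_dominated_convergence summable_nonprime_vonMangoldt_div ?_ ?_
  · intro n
    refine tendsto_const_nhds.congr' ?_
    filter_upwards [eventually_gt_atTop (n : ℝ)] with y hy
    rw [if_neg (not_le.2 hy)]
  · refine Eventually.of_forall fun y n => ?_
    split_ifs with h1 h2
    · simp
    · rw [Real.norm_of_nonneg (by have : 0 ≤ Λ n := vonMangoldt_nonneg; positivity)]
    · simp
    · have : 0 ≤ Λ n := vonMangoldt_nonneg
      rw [norm_zero]; positivity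

/-- At least `x/l - 1` integers lie in `[x, x + x/l]`, where the kernel is at least `l/4`; this
gives `1/8 - l/(8x)`. -/
lemma le_tsum_one_fejer {l x : ℝ} (hl : 1 ≤ l) (hx : 2 * l ≤ x) :
    1 / 16 ≤ ∑' n : ℕ, 1 / (n : ℝ) * fejer l (Real.log n - Real.log x) := by
  have hl0 : 0 < l := by linarith
  have hx0 : 0 < x := by linarith
  refine le_trans ?_ ((summable_one_fejer hl0 hx0).sum_le_tsum (Finset.Icc ⌈x⌉₊ ⌊x + x / l⌋₊)
    fun n _ => by have := fejer_nonneg hl0 (Real.log n - Real.log x); positivity)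
  have hterm : ∀ n ∈ Finset.Icc ⌈x⌉₊ ⌊x + x / l⌋₊,
      1 / (2 * x) * (l / 4) ≤ 1 / (n : ℝ) * fejer l (Real.log n - Real.log x) := by
    intro n hn
    rw [Finset.mem_Icc] at hn
    have h1 : x ≤ n := Nat.ceil_le.1 hn.1
    have hn0 : (0 : ℝ) < n := by linarith
    have h2 : (n : ℝ) ≤ x + x / l := (Nat.le_floor_iff (by positivity)).1 hn.2
    have h3 : x / l ≤ x := div_le_self hx0.le hl
    gcongr
    · linarith
    · refine le_fejer hl0 ?_
      rw [← Real.log_div hn0.ne' hx0.ne', abs_of_nonneg (Real.log_nonneg (by rwa [one_le_div hx0]))]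
      refine (Real.log_le_sub_one_of_pos (by positivity)).trans ?_
      rw [sub_le_iff_le_add, div_le_iff₀ hx0]
      calc (n : ℝ) ≤ x + x / l := h2
        _ = _ := by ring
  refine le_trans ?_ (Finset.card_nsmul_le_sum _ _ _ hterm)
  rw [nsmul_eq_mul, Nat.card_Icc]
  have hcard : x / l - 1 ≤ ((⌊x + x / l⌋₊ + 1 - ⌈x⌉₊ : ℕ) : ℝ) := by
    have h1 := Nat.lt_floor_add_one (x + x / l)
    have h2 := Nat.ceil_lt_add_one hx0.le
    have h3 : ((⌊x + x / l⌋₊ + 1 : ℕ) : ℝ) ≤ ((⌊x + x / l⌋₊ + 1 - ⌈x⌉₊ : ℕ) : ℝ) + (⌈x⌉₊ : ℝ) := by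
      exact_mod_cast le_tsub_add
    push_cast at h3
    linarith
  calc (1 : ℝ) / 16 ≤ (x / l - 1) * (1 / (2 * x) * (l / 4)) := by
        have : (x / l - 1) * (1 / (2 * x) * (l / 4)) = 1 / 8 - l / (8 * x) := by
          field_simp
          ring
        rw [this]
        have : l / (8 * x) ≤ 1 / 16 := by
          rw [div_le_div_iff₀ (by positivity) (by norm_num)]; linarith
        linarith
    _ ≤ _ := by gcongr

/-- Outside the `η`-window the kernel is small; inside it no `n` is prime, so these terms belong to
the tail of a convergent series over proper prime powers. -/
lemma tsum_vonMangoldt_fejer_le {l η x : ℝ} (hl : 0 < l) (hη : 0 < η) (hη1 : η ≤ 1) (hx : 0 < x)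
    (hgap : ∀ p : ℕ, p.Prime → η < |Real.log p - Real.log x|) :
    ∑' n : ℕ, Λ n / n * fejer l (Real.log n - Real.log x) ≤
      l / 2 * (∑' n : ℕ, if x * Real.exp (-η) ≤ n then (if n.Prime then 0 else Λ n / n) else 0)
      + 4 / (l * η ^ 2) * ((Real.log 4 + 4) * windowConst) := by
  have hs1 : Summable fun n : ℕ =>
      if x * Real.exp (-η) ≤ n then (if n.Prime then 0 else Λ n / n) else 0 := by
    refine Summable.of_nonneg_of_le (fun n => ?_) (fun n => ?_) summable_nonprime_vonMangoldt_div
    all_goals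
      have : 0 ≤ Λ n := vonMangoldt_nonneg
      split_ifs
    all_goals first | positivity | exact le_rfl
  have hs2 := summable_vonMangoldt_window hx
  calc _ ≤ ∑' n : ℕ, (l / 2 * (if x * Real.exp (-η) ≤ n then (if n.Prime then 0 else Λ n / n) else 0)
        + 4 / (l * η ^ 2) * (Λ n / n * (1 / (1 + (Real.log n - Real.log x) ^ 2)))) := by
        refine (summable_vonMangoldt_fejer hl hx).tsum_le_tsum (fun n => ?_)
          ((hs1.mul_left _).add (hs2.mul_left _))
        have hL : 0 ≤ Λ n := vonMangoldt_nonneg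
        have h1 : 0 ≤ if x * Real.exp (-η) ≤ n then (if n.Prime then 0 else Λ n / n) else 0 := by
          split_ifs <;> positivity
        by_cases hu : η < |Real.log n - Real.log x|
        · calc _ ≤ Λ n / n * (4 / (l * η ^ 2) * (1 / (1 + (Real.log n - Real.log x) ^ 2))) := by
                gcongr
                exact fejer_le_of_le_abs hl hη hη1 hu.le
            _ = 4 / (l * η ^ 2) * (Λ n / n * (1 / (1 + (Real.log n - Real.log x) ^ 2))) := by ring
            _ ≤ _ := by
                have := mul_nonneg (half_pos hl).le h1
                linarith
        · have hnp : ¬ n.Prime := fun h => hu (hgap n h)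
          rcases Nat.eq_zero_or_pos n with rfl | hn
          · simp
          have hn0 : (0 : ℝ) < n := Nat.cast_pos.2 hn
          have hle : x * Real.exp (-η) ≤ n := by
            rw [← Real.log_le_log_iff (by positivity) hn0, Real.log_mul hx.ne' (Real.exp_ne_zero _),
              Real.log_exp]
            linarith [neg_le_of_abs_le (not_lt.1 hu)]
          rw [if_pos hle, if_neg hnp]
          calc _ ≤ Λ n / n * (l / 2) := by gcongr; exact fejer_le hl _
            _ = l / 2 * (Λ n / n) := mul_comm _ _
            _ ≤ _ := le_add_of_nonneg_right (by positivity)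
    _ = l / 2 * (∑' n : ℕ, if x * Real.exp (-η) ≤ n then (if n.Prime then 0 else Λ n / n) else 0)
        + 4 / (l * η ^ 2) * (∑' n : ℕ, Λ n / n * (1 / (1 + (Real.log n - Real.log x) ^ 2))) := by
        rw [(hs1.mul_left _).tsum_add (hs2.mul_left _), tsum_mul_left, tsum_mul_left]
    _ ≤ _ := by
        gcongr
        exact tsum_vonMangoldt_window_le hx

/-- Every sufficiently far multiplicative window contains a prime. -/
theorem eventually_exists_prime_log_near {η : ℝ} (hη : 0 < η) (hη1 : η ≤ 1) :
    ∀ᶠ x : ℝ in atTop, ∃ p : ℕ, p.Prime ∧ |Real.log p - Real.log x| ≤ η := by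
  set D := (Real.log 4 + 4) * windowConst with hD
  have hD0 : 0 ≤ D := mul_nonneg log_four_add_four_pos.le windowConst_nonneg
  obtain ⟨l, hl1, hl2⟩ : ∃ l : ℝ, 1 ≤ l ∧ 4 / (l * η ^ 2) * D ≤ 1 / 64 := by
    -- `256 = 4 * 64`. Three errors of `1/64` then stay below the lower bound `1/16`.
    refine ⟨1 + 256 * D / η ^ 2, by simp; positivity, ?_⟩
    have : (1 + 256 * D / η ^ 2) * η ^ 2 = η ^ 2 + 256 * D := by field_simp
    rw [this, div_mul_eq_mul_div, div_le_div_iff₀ (by positivity) (by norm_num)]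
    nlinarith [sq_nonneg η]
  have hl0 : 0 < l := by linarith
  have ht2 : ∀ᶠ x : ℝ in atTop, l / 2 * (∑' n : ℕ, if x * Real.exp (-η) ≤ n then
      (if n.Prime then 0 else Λ n / n) else 0) < 1 / 64 := by
    have h1 := (tendsto_tail_nonprime.comp
      (tendsto_id.atTop_mul_const (Real.exp_pos (-η)))).const_mul (l / 2)
    rw [mul_zero] at h1
    exact h1.eventually (gt_mem_nhds (by norm_num))
  have ht3 : ∀ᶠ x : ℝ in atTop, -(1 / 64) < (zetaAuxTransform l 1 x).re := by
    have : Tendsto (fun x => (zetaAuxTransform l 1 x).re) atTop (𝓝 0) := by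
      simpa [Function.comp_def] using (Complex.continuous_re.tendsto 0).comp
        (tendsto_zetaAuxTransform_atTop hl0)
    exact this.eventually (lt_mem_nhds (by norm_num))
  filter_upwards [ht2, ht3, eventually_ge_atTop (2 * l)] with x h2 h3 h4
  by_contra! hgap
  have hx0 : 0 < x := by linarith
  have h5 := tsum_vonMangoldt_fejer_le hl0 hη hη1 hx0 hgap
  have h6 := tsum_fejer_sub_tsum_fejer hl0 hx0
  have h7 := le_tsum_one_fejer hl1 h4
  linarith

lemma nextPrime_spec (x : ℝ) : (nextPrime x).Prime ∧ x ≤ (nextPrime x : ℝ) := by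
  refine Nat.sInf_mem (s := {p : ℕ | p.Prime ∧ x ≤ (p : ℝ)}) ?_
  obtain ⟨p, hp, hp'⟩ := Nat.exists_infinite_primes ⌈x⌉₊
  exact ⟨p, hp', (Nat.le_ceil x).trans (by exact_mod_cast hp)⟩

/-- The smallest prime `≥ x` is asymptotic to `x`. -/
theorem tendsto_nextPrime_div : Tendsto (fun x : ℝ => (nextPrime x : ℝ) / x) atTop (𝓝 1) := by
  have hexp : Tendsto (fun η : ℝ => Real.exp (2 * η)) (𝓝 0) (𝓝 1) := by
    have : Continuous fun η : ℝ => Real.exp (2 * η) := by fun_prop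
    simpa using this.tendsto 0
  rw [tendsto_order]
  constructor
  · intro a ha
    filter_upwards [eventually_gt_atTop 0] with x hx
    exact ha.trans_le ((one_le_div hx).2 (nextPrime_spec x).2)
  · intro a ha
    obtain ⟨η, hη, hη0, hη1⟩ : ∃ η : ℝ, Real.exp (2 * η) < a ∧ 0 < η ∧ η ≤ 1 := by
      have h1 := (hexp.mono_left nhdsWithin_le_nhds).eventually (gt_mem_nhds ha)
        |>.and (Ioo_mem_nhdsGT (zero_lt_one (α := ℝ)))
      obtain ⟨η, h2, h3⟩ := h1.exists
      exact ⟨η, h2, h3.1, h3.2.le⟩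
    have hmul : Tendsto (fun x : ℝ => x * Real.exp η) atTop atTop :=
      tendsto_id.atTop_mul_const (Real.exp_pos η)
    -- Centring the window at `x * exp η` places the prime in `[x, x * exp (2η)]`.
    filter_upwards [hmul.eventually (eventually_exists_prime_log_near hη0 hη1),
      eventually_gt_atTop 0] with x ⟨p, hp, hpx⟩ hx
    have hp0 : (0 : ℝ) < p := Nat.cast_pos.2 hp.pos
    rw [Real.log_mul hx.ne' (Real.exp_ne_zero _), Real.log_exp, abs_le] at hpx
    have h1 : x ≤ p := by
      rw [← Real.log_le_log_iff hx hp0]; linarith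
    have h2 : (p : ℝ) ≤ x * Real.exp (2 * η) := by
      rw [← Real.log_le_log_iff hp0 (by positivity), Real.log_mul hx.ne' (Real.exp_ne_zero _),
        Real.log_exp]
      linarith
    have h3 : (nextPrime x : ℝ) ≤ p := by
      exact_mod_cast Nat.sInf_le (show p ∈ {p : ℕ | p.Prime ∧ x ≤ (p : ℝ)} from ⟨hp, h1⟩)
    rw [div_lt_iff₀ hx]
    nlinarith

end PrimeGaps
end DirichletMurmuration
namespace DirichletMurmuration

/-! ### Averaging over the conductors -/

section Murmuration

/-- The limiting density: `cos (2πu)` for `s = 1` and `-i sin (2πu)` for `s = -1`. -/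
noncomputable def density (s : ℂ) (u : ℝ) : ℂ :=
  (Complex.exp (-(2 * Real.pi * Complex.I * u)) + s * Complex.exp (2 * Real.pi * Complex.I * u)) / 2

lemma continuous_density (s : ℂ) : Continuous (density s) := by
  unfold density; fun_prop

lemma density_one (u : ℝ) : density 1 u = ((Real.cos (2 * Real.pi * u) : ℝ) : ℂ) := by
  rw [density, Complex.ofReal_cos, Complex.cos]
  push_cast
  ring_nf

lemma density_neg_one (u : ℝ) :
    density (-1) u = -Complex.I * ((Real.sin (2 * Real.pi * u) : ℝ) : ℂ) := by
  rw [density, Complex.ofReal_sin, Complex.sin]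
  have : ∀ a b : ℂ, (a + -1 * b) / 2 = -Complex.I * ((a - b) * Complex.I / 2) := fun a b => by
    linear_combination ((a - b) / 2) * Complex.I_mul_I
  rw [this]
  push_cast
  ring_nf

lemma norm_density_le_one {s : ℂ} (hs : s = 1 ∨ s = -1) (u : ℝ) : ‖density s u‖ ≤ 1 := by
  rcases hs with rfl | rfl
  · rw [density_one, Complex.norm_real]; exact Real.abs_cos_le_one _
  · rw [density_neg_one, norm_mul, norm_neg, Complex.norm_I, one_mul, Complex.norm_real]
    exact Real.abs_sin_le_one _

lemma stdAddChar_eq_density {N : ℕ} [NeZero N] (s : ℂ) (q : ℕ) :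
    (ZMod.stdAddChar (-(q : ZMod N)) + s * ZMod.stdAddChar (q : ZMod N)) / 2
      = density s ((q : ℝ) / N) := by
  have h1 := ZMod.stdAddChar_coe (N := N) (q : ℤ)
  have h2 := ZMod.stdAddChar_coe (N := N) (-(q : ℤ))
  push_cast at h1 h2
  rw [h1, h2, density]
  push_cast
  ring_nf

lemma totient_div_le_one (N : ℕ) : (N.totient : ℝ) / N ≤ 1 :=
  div_le_one_of_le₀ (by exact_mod_cast N.totient_le) (Nat.cast_nonneg N)

/-- The primitive characters mod `N` of parity `s`. -/
def signPrimitive (s : ℂ) (N : ℕ) : Set (DirichletCharacter ℂ N) :=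
  {χ | χ.IsPrimitive ∧ χ (-1) = s}

/-- If `q ∣ N`, then `N < q²` rules out squarefull `N`, so `N = q`; the character sum is then `0`
and the indicator pays for it. -/
lemma norm_char_sum_sub_le {N q : ℕ} (hN : N ∈ S) (hq : q.Prime) (hNq : N < q ^ 2) {s : ℂ}
    (hs : s = 1 ∨ s = -1) {X y ε : ℝ} (hX : 0 < X) (hXN : X ≤ N) (hε0 : 0 ≤ ε)
    (hε : ‖density s ((q : ℝ) / N) - density s y‖ ≤ ε) :
    ‖∑ᶠ χ ∈ signPrimitive s N, χ (q : ZMod N) / tau χ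
      - ((N.totient : ℝ) / N : ℝ) * density s y‖
      ≤ 1 / X + ε * ((N.totient : ℝ) / N) + if N = q then 1 else 0 := by
  have hNpos : 0 < N := hN.1
  have : NeZero N := ⟨hNpos.ne'⟩
  have hif : (0 : ℝ) ≤ if N = q then 1 else 0 := by split_ifs <;> norm_num
  by_cases hu : IsUnit (q : ZMod N)
  · have h1 := norm_sum_div_tau_sub_le hN.2.2 hu hs
    rw [stdAddChar_eq_density] at h1
    have h2 : ‖((N.totient : ℂ) / N * density s ((q : ℝ) / N))
        - ((N.totient : ℝ) / N : ℝ) * density s y‖ ≤ ε * ((N.totient : ℝ) / N) := by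
      push_cast
      rw [← mul_sub, norm_mul, mul_comm]
      gcongr
      rw [norm_div, Complex.norm_natCast, Complex.norm_natCast]
    have h3 : 1 / (N : ℝ) ≤ 1 / X := by gcongr
    have h4 := norm_sub_le_norm_sub_add_norm_sub
      (∑ᶠ χ ∈ signPrimitive s N, χ (q : ZMod N) / tau χ)
      ((N.totient : ℂ) / N * density s ((q : ℝ) / N))
      (((N.totient : ℝ) / N : ℝ) * density s y)
    have h5 : ‖∑ᶠ χ ∈ signPrimitive s N, χ (q : ZMod N) / tau χ -
      ((N.totient : ℂ) / N * density s ((q : ℝ) / N))‖ ≤ 1 / N := h1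
    linarith
  · have hdvd : q ∣ N := by
      rw [ZMod.isUnit_iff_coprime] at hu
      exact (Nat.Prime.dvd_iff_not_coprime hq).2 hu
    have hNeq : N = q := by
      rcases hN.2.2 with h | h
      · exact ((Nat.prime_dvd_prime_iff_eq hq h).1 hdvd).symm
      · exact absurd (Nat.le_of_dvd hNpos (h.2 q hq hdvd)) (not_le.2 hNq)
    have h0 : ∑ᶠ χ ∈ signPrimitive s N, χ (q : ZMod N) / tau χ = 0 := by
      refine finsum_mem_eq_zero_of_forall_eq_zero fun χ _ => ?_
      rw [MulChar.map_nonunit _ hu, zero_div]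
    rw [h0, zero_sub, norm_neg, norm_mul, Complex.norm_real, if_pos hNeq,
      Real.norm_of_nonneg (by positivity)]
    have h1 := mul_le_one₀ (totient_div_le_one N) (norm_nonneg _) (norm_density_le_one hs y)
    have : 0 ≤ 1 / X + ε * ((N.totient : ℝ) / N) := by positivity
    linarith

open Classical in
lemma abs_sum_totient_div_sub_le {X Y : ℝ} (hXY : X ≤ Y) :
    |∑ N ∈ (Finset.Icc ⌈X⌉₊ ⌊Y⌋₊).filter (fun N => N ∈ S), (N.totient : ℝ) / N - (f Y - f X)|
      ≤ 1 := by
  rw [f_sub_f hXY]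
  set A := (Finset.Ioc ⌊X⌋₊ ⌊Y⌋₊).filter (fun N => N ∈ S)
  set B := (Finset.Icc ⌈X⌉₊ ⌊Y⌋₊).filter (fun N => N ∈ S)
  have hAB : A ⊆ B := by
    intro N hN
    simp only [A, B, Finset.mem_filter, Finset.mem_Ioc, Finset.mem_Icc] at hN ⊢
    exact ⟨⟨(Nat.ceil_le_floor_add_one X).trans hN.1.1, hN.1.2⟩, hN.2⟩
  have hBA : B \ A ⊆ {⌊X⌋₊} := by
    intro N hN
    simp only [A, B, Finset.mem_sdiff, Finset.mem_filter, Finset.mem_Ioc, Finset.mem_Icc] at hN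
    have h1 : ⌊X⌋₊ ≤ N := (Nat.floor_le_ceil X).trans hN.1.1.1
    have h2 : ¬ ⌊X⌋₊ < N := fun h => hN.2 ⟨⟨h, hN.1.1.2⟩, hN.1.2⟩
    rw [Finset.mem_singleton]
    omega
  rw [← Finset.sum_sdiff hAB, add_sub_cancel_right, abs_of_nonneg
    (Finset.sum_nonneg fun N _ => by positivity)]
  refine (Finset.sum_le_sum_of_subset_of_nonneg hBA fun N _ _ => by positivity).trans ?_
  rw [Finset.sum_singleton]
  exact totient_div_le_one _

lemma card_Icc_ceil_floor_le {X Y : ℝ} (hXY : X ≤ Y) (hX : 0 ≤ X) :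
    ((Finset.Icc ⌈X⌉₊ ⌊Y⌋₊).card : ℝ) ≤ Y - X + 1 := by
  rw [Nat.card_Icc]
  rcases le_or_gt ⌈X⌉₊ (⌊Y⌋₊ + 1) with h | h
  · rw [Nat.cast_sub h]
    push_cast
    linarith [Nat.le_ceil X, Nat.floor_le (hX.trans hXY)]
  · rw [Nat.sub_eq_zero_of_le h.le]
    push_cast
    linarith

/-- The `4` is `2` for the `1/X` errors over at most `2X` moduli, `1` for `N = q`, and `1` for the
endpoint. -/
lemma norm_QS_sub_le {s : ℂ} (hs : s = 1 ∨ s = -1) {y X δ ε : ℝ} (hX : 1 ≤ X) (hδ : δ ≤ 1)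
    (hε0 : 0 ≤ ε) (hf : 0 < f (X + X ^ δ) - f X)
    (hq : X + X ^ δ < (nextPrime (y * X) : ℝ) ^ 2)
    (hε : ∀ N : ℝ, X ≤ N → N ≤ X + X ^ δ →
      ‖density s ((nextPrime (y * X) : ℝ) / N) - density s y‖ ≤ ε) :
    ‖QS (signPrimitive s) y X δ - density s y‖ ≤
      (ε * (f (X + X ^ δ) - f X + 1) + 4) / (f (X + X ^ δ) - f X) := by
  classical
  have hX0 : 0 < X := by linarith
  have hle : X ≤ X + X ^ δ := le_add_of_nonneg_right (by positivity)
  have hab := abs_sum_totient_div_sub_le hle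
  set Δ := f (X + X ^ δ) - f X with hΔ
  set q := nextPrime (y * X)
  set B := (Finset.Icc ⌈X⌉₊ ⌊X + X ^ δ⌋₊).filter (fun N => N ∈ S) with hB
  set W := ∑ N ∈ B, (N.totient : ℝ) / N with hW
  have hcard : (B.card : ℝ) * (1 / X) ≤ 2 := by
    have h1 : (B.card : ℝ) ≤ X + X ^ δ - X + 1 :=
      le_trans (by exact_mod_cast Finset.card_filter_le _ _) (card_Icc_ceil_floor_le hle hX0.le)
    have h2 := rpow_le_self hX hδ
    rw [mul_one_div, div_le_iff₀ hX0]
    linarith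
  have hsum : ‖∑ N ∈ B, (∑ᶠ χ ∈ signPrimitive s N, χ (q : ZMod N) / tau χ
      - ((N.totient : ℝ) / N : ℝ) * density s y)‖ ≤ 2 + ε * W + 1 := by
    calc _ ≤ ∑ N ∈ B, (1 / X + ε * ((N.totient : ℝ) / N) + if N = q then 1 else 0) := by
          refine norm_sum_le_of_le _ fun N hN => ?_
          rw [hB, Finset.mem_filter, Finset.mem_Icc] at hN
          have h1 : X ≤ N := Nat.ceil_le.1 hN.1.1
          have h2 : (N : ℝ) ≤ X + X ^ δ := (Nat.le_floor_iff (by positivity)).1 hN.1.2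
          refine norm_char_sum_sub_le hN.2 (nextPrime_spec _).1 ?_ hs hX0 h1 hε0 (hε N h1 h2)
          exact_mod_cast h2.trans_lt hq
      _ = B.card * (1 / X) + ε * W + ∑ N ∈ B, (if N = q then 1 else 0) := by
          rw [Finset.sum_add_distrib, Finset.sum_add_distrib, Finset.sum_const, nsmul_eq_mul,
            ← Finset.mul_sum]
      _ ≤ 2 + ε * W + 1 := by
          gcongr
          rw [Finset.sum_ite_eq']
          split_ifs <;> norm_num
  have hΔ0 : (Δ : ℂ) ≠ 0 := Complex.ofReal_ne_zero.2 hf.ne'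
  have hQ : QS (signPrimitive s) y X δ - density s y =
      (∑ N ∈ B, (∑ᶠ χ ∈ signPrimitive s N, χ (q : ZMod N) / tau χ
      - ((N.totient : ℝ) / N : ℝ) * density s y) + ((W - Δ : ℝ) : ℂ) * density s y) / Δ := by
    have : QS (signPrimitive s) y X δ =
        1 / (Δ : ℂ) * ∑ N ∈ B, ∑ᶠ χ ∈ signPrimitive s N, χ (q : ZMod N) / tau χ := by
      rw [QS]
    rw [this, Finset.sum_sub_distrib, ← Finset.sum_mul, ← Complex.ofReal_sum, ← hW]
    push_cast
    field_simp
    ring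
  rw [hQ, norm_div, Complex.norm_real, Real.norm_of_nonneg hf.le]
  gcongr
  refine (norm_add_le _ _).trans ?_
  rw [norm_mul, Complex.norm_real, Real.norm_eq_abs]
  have h1 : |W - Δ| * ‖density s y‖ ≤ 1 :=
    mul_le_one₀ hab (norm_nonneg _) (norm_density_le_one hs y)
  have h2 : W ≤ Δ + 1 := by linarith [(abs_le.1 hab).2]
  have h3 : ε * W ≤ ε * (Δ + 1) := by gcongr
  linarith

theorem tendsto_QS_signPrimitive {s : ℂ} (hs : s = 1 ∨ s = -1) {δ y : ℝ}
    (hδ : δ ∈ Set.Ioo (1 / 2 : ℝ) 1) (hy : 0 < y) :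
    Tendsto (fun X : ℝ => QS (signPrimitive s) y X δ) atTop (𝓝 (density s y)) := by
  have hΔ := tendsto_f_sub_f hδ
  have hq : Tendsto (fun X : ℝ => (nextPrime (y * X) : ℝ) / X) atTop (𝓝 y) := by
    have h1 := (tendsto_nextPrime_div.comp (tendsto_id.const_mul_atTop hy)).const_mul y
    rw [mul_one] at h1
    refine h1.congr' ?_
    filter_upwards [eventually_gt_atTop 0] with X hX
    simp only [Function.comp_apply, id]
    field_simp
  have hratio : Tendsto (fun X : ℝ => (X + X ^ δ) / X) atTop (𝓝 1) := by
    have h1 : Tendsto (fun X : ℝ => 1 + X ^ (-(1 - δ))) atTop (𝓝 (1 + 0)) :=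
      (tendsto_rpow_neg_atTop (by linarith [hδ.2])).const_add 1
    rw [add_zero] at h1
    refine h1.congr' ?_
    filter_upwards [eventually_gt_atTop 0] with X hX
    rw [add_div, div_self hX.ne', ← Real.rpow_sub_one hX.ne']
    congr 2
    ring
  have hq2 : Tendsto (fun X : ℝ => (nextPrime (y * X) : ℝ) / (X + X ^ δ)) atTop (𝓝 y) := by
    have h1 := hq.div hratio one_ne_zero
    rw [div_one] at h1
    refine h1.congr' ?_
    filter_upwards [eventually_gt_atTop 0] with X hX
    simp only [Pi.div_apply]
    field_simp
  rw [Metric.tendsto_nhds]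
  intro ε hε
  obtain ⟨r, hr, hr'⟩ := Metric.continuousAt_iff.1 (continuous_density s).continuousAt
    (ε / 3) (by positivity)
  -- Ensures `X + X^δ ≤ 2X < (yX)² ≤ q²`.
  have hlarge : ∀ᶠ X : ℝ in atTop, 2 / y ^ 2 < X := eventually_gt_atTop _
  filter_upwards [hΔ.eventually_gt_atTop 1, hΔ.eventually_gt_atTop (12 / ε), hlarge,
    eventually_ge_atTop 1, (tendsto_order.1 hq).2 (y + r) (by linarith),
    (tendsto_order.1 hq2).1 (y - r) (by linarith)] with X h1 h2 h3 h4 h5 h6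
  have hX0 : 0 < X := by linarith
  have hXδ := rpow_le_self h4 hδ.2.le
  have hXδ0 : 0 < X ^ δ := by positivity
  have hq0 : (0 : ℝ) ≤ (nextPrime (y * X) : ℝ) := Nat.cast_nonneg _
  have hQ := norm_QS_sub_le hs (y := y) (ε := ε / 3) h4 hδ.2.le (by positivity) (by linarith) ?_ ?_
  · rw [dist_eq_norm]
    refine hQ.trans_lt ?_
    rw [div_lt_iff₀ (by linarith)]
    rw [div_lt_iff₀ hε] at h2
    -- With `Δ` the normalising factor, `Δ > 1` and `εΔ > 12` bound `ε/3` and `4` each by `εΔ/3`.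
    nlinarith
  · have h7 := (nextPrime_spec (y * X)).2
    rw [div_lt_iff₀ (by positivity)] at h3
    have h8 : (y * X) ^ 2 ≤ (nextPrime (y * X) : ℝ) ^ 2 := by gcongr
    nlinarith
  · intro N hN1 hN2
    have hN0 : 0 < N := by linarith
    rw [← dist_eq_norm]
    refine (hr' ?_).le
    rw [Real.dist_eq, abs_lt]
    have h7 : (nextPrime (y * X) : ℝ) / N ≤ (nextPrime (y * X) : ℝ) / X := by gcongr
    have h8 : (nextPrime (y * X) : ℝ) / (X + X ^ δ) ≤ (nextPrime (y * X) : ℝ) / N := by gcongr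
    constructor <;> linarith

end Murmuration
end DirichletMurmuration

theorem mainTheorem6 (hRH : RiemannHypothesis) (δ : ℝ) (hδ : δ ∈ Set.Ioo (1 / 2 : ℝ) 1)
    (y : ℝ) (hy : 0 < y) :
    Tendsto (fun X : ℝ => DirichletMurmuration.QS DirichletMurmuration.evenPrimitive y X δ)
        atTop (𝓝 ((Real.cos (2 * Real.pi * y) : ℝ) : ℂ)) ∧
      Tendsto (fun X : ℝ => DirichletMurmuration.QS DirichletMurmuration.oddPrimitive y X δ)
        atTop (𝓝 (-Complex.I * ((Real.sin (2 * Real.pi * y) : ℝ) : ℂ))) := by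
  rw [← DirichletMurmuration.density_one, ← DirichletMurmuration.density_neg_one]
  exact ⟨DirichletMurmuration.tendsto_QS_signPrimitive (Or.inl rfl) hδ hy,
    DirichletMurmuration.tendsto_QS_signPrimitive (Or.inr rfl) hδ hy⟩
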